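/- Work in homotopy type theory: intensional Martin-Löf type theory with dependent functions and pairs, sums, identity types, $\mathbf 0$, $\mathbf 1$, $\mathbf 2=\{\mathsf{ff},\mathsf{tt}\}$, $\mathbb N$, a cumulative hierarchy of universes, the univalence axiom and propositional truncation (so $\exists(x:A).B(x)$ denotes the truncation of $\Sigma(x:A).B(x)$), together with the quotient inductive-inductive type of Brouwer trees. The latter consists of a set $\mathsf{Brw}$ and a proposition-valued relation $\leq$ on it, generated simultaneously by the constructors $\mathsf{zero}:\mathsf{Brw}$; $\mathsf{succ}:\mathsf{Brw}\to\mathsf{Brw}$; $\mathsf{limit}\,f:\mathsf{Brw}$ for every $f:\mathbb N\to\mathsf{Brw}$ with $f(k)<f(k+1)$ for all $k$; $\mathsf{limit}\,f=\mathsf{limit}\,g$ whenever $\forall k.\exists n.\,f(k)\leq g(n)$ and $\forall k.\exists n.\,g(k)\leq f(n)$; and $\mathsf{zero}\leq x$; $x\leq y\to y\leq z\to x\leq z$; $x\leq y\to\mathsf{succ}\,x\leq\mathsf{succ}\,y$; $x\leq f(k)\to x\leq\mathsf{limit}\,f$; $(\forall k.\,f(k)\leq x)\to\mathsf{limit}\,f\leq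 x$; where $x<y$ means $\mathsf{succ}\,x\leq y$. Theorem. The following three types are logically equivalent, i.e. for any two of them there are closed terms of this type theory for the functions in both directions: (i) the limited principle of omniscience $\mathsf{LPO}$: $\forall(s:\mathbb N\to\mathbf 2).\ (\forall n.\,s_n=\mathsf{ff})\uplus(\exists n.\,s_n=\mathsf{tt})$; (ii) trichotomy: $\forall(x,y:\mathsf{Brw}).\ (x<y)\uplus(x=y)\uplus(y<x)$; (iii) splitting of $\leq$: $\forall(x,y:\mathsf{Brw}).\ (x\leq y)\to(x<y)\uplus(x=y)$. -/

import Mathlib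

/-!
# Homotopy type theory with Brouwer trees, as a formal system

Lean is classical, so the principle LPO is simply true for the functions of Lean. The
equivalences below are statements about derivability in homotopy type theory; therefore the type
theory itself is defined here: Martin-Löf type theory with a cumulative hierarchy of universes,
the univalence axiom, propositional truncation and the quotient inductive-inductive type of
Brouwer trees. The presentation has raw terms built from variables, abstraction, application and
constants, a convertibility relation on raw terms, and a typing relation.
-/

namespace HoTT

/-- The primitive constants. -/
inductive Cst : Type
  -- finite types, natural numbers
  | empty | emptyElim
  | unit | star | unitElim
  | bool | ff | tt | boolElim
  | nat | zero | suc | natElim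
  -- sums, dependent pairs, identity types
  | sum | inl | inr | sumElim
  | sigma | pair | sigmaElim
  | id | refl | idElim
  -- propositional truncation
  | trunc | truncIn | truncIsProp | truncElim
  -- function extensionality and univalence
  | funext | univalence
  -- Brouwer trees and their order
  | brw | le
  | bzero | bsucc | blimit | bisim | brwIsSet
  | leZero | leTrans | leSuccMono | leCocone | leLimiting | leIsProp
  | brwElim | leElim
  deriving DecidableEq

/-- Raw terms, with de Bruijn indices. Types are terms, and universes are à la Russell. -/
inductive Tm : Type
  | var (n : ℕ)
  | univ (i : ℕ)
  | pi (A B : Tm)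
  | lam (b : Tm)
  | app (f a : Tm)
  | cst (c : Cst)
  deriving DecidableEq

namespace Tm

/-- Extension of a renaming under a binder. -/
def upRen (ρ : ℕ → ℕ) : ℕ → ℕ
  | 0 => 0
  | n + 1 => ρ n + 1

/-- Renaming of variables. -/
def rename : Tm → (ℕ → ℕ) → Tm
  | var n, ρ => var (ρ n)
  | univ i, _ => univ i
  | pi A B, ρ => pi (A.rename ρ) (B.rename (upRen ρ))
  | lam b, ρ => lam (b.rename (upRen ρ))
  | app f a, ρ => app (f.rename ρ) (a.rename ρ)
  | cst c, _ => cst c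

/-- Weakening by `k` variables. -/
def shift (k : ℕ) (t : Tm) : Tm := t.rename (fun n => n + k)

/-- Extension of a substitution under a binder. -/
def upSub (σ : ℕ → Tm) : ℕ → Tm
  | 0 => var 0
  | n + 1 => (σ n).shift 1

/-- Simultaneous capture-avoiding substitution. -/
def subst : Tm → (ℕ → Tm) → Tm
  | var n, σ => σ n
  | univ i, _ => univ i
  | pi A B, σ => pi (A.subst σ) (B.subst (upSub σ))
  | lam b, σ => lam (b.subst (upSub σ))
  | app f a, σ => app (f.subst σ) (a.subst σ)
  | cst c, _ => cst c

/-- Substitution of `a` for the last variable of `b`. -/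
def inst (b a : Tm) : Tm :=
  b.subst (fun n => match n with
    | 0 => a
    | m + 1 => var m)

end Tm

/-! ## Writing terms with named variables

An `Exp` is a term written as a function of the number `d` of variables in scope. A variable that
is bound when `d` variables are in scope has, when `d'` variables are in scope, the de Bruijn
index `d' - (d + 1)`. Hence binders can be written as functions of Lean. -/

/-- A term, given at each number of variables in scope. -/
def Exp : Type := ℕ → Tm

/-- The closed term that is denoted by an expression. -/
def Exp.closed (e : Exp) : Tm := e 0

instance : Coe Cst Exp := ⟨fun c _ => Tm.cst c⟩

/-- Application. -/
def Exp.app (f a : Exp) : Exp := fun d => Tm.app (f d) (a d)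

infixl:70 " ⬝ " => Exp.app

/-- The universe of level `i`. -/
def U (i : ℕ) : Exp := fun _ => Tm.univ i

/-- The variable that is bound when `d` variables are in scope. -/
def bound (d : ℕ) : Exp := fun d' => Tm.var (d' - (d + 1))

/-- Abstraction `λ x. b x`. -/
def lam (b : Exp → Exp) : Exp := fun d => Tm.lam (b (bound d) (d + 1))

/-- Dependent function type `(x : A) → B x`. -/
def Pi (A : Exp) (B : Exp → Exp) : Exp := fun d => Tm.pi (A d) (B (bound d) (d + 1))

/-- Function type. -/
def arrow (A B : Exp) : Exp := Pi A fun _ => B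

infixr:25 " ⇒ " => arrow

/-! ## Derived notions of type theory -/

/-- Identity type `x =_A y`. -/
def Eq (A x y : Exp) : Exp := Cst.id ⬝ A ⬝ x ⬝ y

/-- Sum type. -/
def Sum (A B : Exp) : Exp := Cst.sum ⬝ A ⬝ B

/-- Type of dependent pairs `Σ (x : A). B x`. -/
def Sigma (A : Exp) (B : Exp → Exp) : Exp := Cst.sigma ⬝ A ⬝ lam B

/-- Binary product. -/
def Prod (A B : Exp) : Exp := Sigma A fun _ => B

/-- The pair `(a, b)` in `Σ (x : A). B x`. -/
def mkPair (A : Exp) (B : Exp → Exp) (a b : Exp) : Exp := Cst.pair ⬝ A ⬝ lam B ⬝ a ⬝ b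

/-- First projection from `Σ (x : A). B x`. -/
def fst (A : Exp) (B : Exp → Exp) (p : Exp) : Exp :=
  Cst.sigmaElim ⬝ A ⬝ lam B ⬝ (lam fun _ => A) ⬝ (lam fun a => lam fun _ => a) ⬝ p

/-- Second projection from `Σ (x : A). B x`. -/
def snd (A : Exp) (B : Exp → Exp) (p : Exp) : Exp :=
  Cst.sigmaElim ⬝ A ⬝ lam B ⬝ (lam fun q => B (fst A B q)) ⬝ (lam fun _ => lam fun b => b) ⬝ p

/-- Logical equivalence: functions in both directions. -/
def Iff (A B : Exp) : Exp := Prod (A ⇒ B) (B ⇒ A)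

/-- All elements of `A` are equal. -/
def isProp (A : Exp) : Exp := Pi A fun x => Pi A fun y => Eq A x y

/-- All identity types of `A` are propositions. -/
def isSet (A : Exp) : Exp := Pi A fun x => Pi A fun y => isProp (Eq A x y)

/-- `∃ (x : A). B x`, the propositional truncation of `Σ (x : A). B x`. -/
def Ex (A : Exp) (B : Exp → Exp) : Exp := Cst.trunc ⬝ Sigma A B

/-- Transport of `u : P ⬝ x` along `p : x =_A y`. -/
def transport (A P x y p u : Exp) : Exp :=
  Cst.idElim ⬝ A ⬝ (lam fun x => lam fun y => lam fun _ => P ⬝ x ⇒ P ⬝ y)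
    ⬝ (lam fun _ => lam fun u => u) ⬝ x ⬝ y ⬝ p ⬝ u

/-- The identity function. -/
def idFun : Exp := lam fun x => x

/-- `f` has a right inverse. -/
def hasSection (A B f : Exp) : Exp :=
  Sigma (B ⇒ A) fun g => Pi B fun y => Eq B (f ⬝ (g ⬝ y)) y

/-- `f` has a left inverse. -/
def hasRetraction (A B f : Exp) : Exp :=
  Sigma (B ⇒ A) fun h => Pi A fun x => Eq A (h ⬝ (f ⬝ x)) x

/-- `f : A ⇒ B` is an equivalence (it has a left inverse and a right inverse). -/
def isEquiv (A B f : Exp) : Exp := Prod (hasSection A B f) (hasRetraction A B f)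

/-- Type of equivalences. -/
def Equiv (A B : Exp) : Exp := Sigma (A ⇒ B) fun f => isEquiv A B f

/-- The identity equivalence. -/
def idEquiv (A : Exp) : Exp :=
  mkPair (A ⇒ A) (fun f => isEquiv A A f) idFun
    (mkPair (hasSection A A idFun) (fun _ => hasRetraction A A idFun)
      (mkPair (A ⇒ A) (fun g => Pi A fun y => Eq A (idFun ⬝ (g ⬝ y)) y) idFun
        (lam fun y => Cst.refl ⬝ A ⬝ y))
      (mkPair (A ⇒ A) (fun h => Pi A fun x => Eq A (h ⬝ (idFun ⬝ x)) x) idFun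
        (lam fun x => Cst.refl ⬝ A ⬝ x)))

/-- The canonical function from `A = B` (in the universe of level `i`) to equivalences. -/
def idToEquiv (i : ℕ) (A B : Exp) : Exp :=
  lam fun p => Cst.idElim ⬝ U i ⬝ (lam fun A => lam fun B => lam fun _ => Equiv A B)
    ⬝ (lam fun A => idEquiv A) ⬝ A ⬝ B ⬝ p

/-! ## Brouwer trees -/

/-- `x ≤ y` for Brouwer trees. -/
def Le (x y : Exp) : Exp := Cst.le ⬝ x ⬝ y

/-- `x < y` for Brouwer trees, defined as `succ x ≤ y`. -/
def Lt (x y : Exp) : Exp := Le (Cst.bsucc ⬝ x) y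

/-- `f` is strictly increasing. -/
def isIncr (f : Exp) : Exp := Pi Cst.nat fun k => Lt (f ⬝ k) (f ⬝ (Cst.suc ⬝ k))

/-- The type of strictly increasing sequences of Brouwer trees. -/
def Incr : Exp := Sigma (Cst.nat ⇒ Cst.brw) isIncr

/-- The term `f k` of an increasing sequence. -/
def at' (f k : Exp) : Exp := fst (Cst.nat ⇒ Cst.brw) isIncr f ⬝ k

/-- The proof of `f k < f (k + 1)` contained in an increasing sequence. -/
def incr (f k : Exp) : Exp := snd (Cst.nat ⇒ Cst.brw) isIncr f ⬝ k

/-- `f` is simulated by `g`: `∀ k. ∃ n. f k ≤ g n`. -/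
def Sim (f g : Exp) : Exp :=
  Pi Cst.nat fun k => Ex Cst.nat fun n => Le (at' f k) (at' g n)

/-- `f` and `g` are bisimilar. -/
def Bisim (f g : Exp) : Exp := Prod (Sim f g) (Sim g f)

/-- The data for an induction on Brouwer trees and their order, named as follows.
* `P`, `Q`: the motives over Brouwer trees and over `≤`;
* `pZero`, `pSucc`, `pLimit`, `pBisim`, `pSet`: the methods for the constructors of the type of
  Brouwer trees (the last one for the constructor that makes it a set);
* `qZero`, `qTrans`, `qSucc`, `qCocone`, `qLimiting`, `qProp`: the methods for the constructors
  of `≤` (the last one for the constructor that makes it a proposition). -/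
structure Alg where
  (P Q pZero pSucc pLimit pBisim pSet qZero qTrans qSucc qCocone qLimiting qProp : Exp)

namespace Alg

/-- The type of the motive over Brouwer trees. -/
def tyP (j : ℕ) : Exp := Cst.brw ⇒ U j

/-- The type of the motive over `≤`. -/
def tyQ (j : ℕ) (P : Exp) : Exp :=
  Pi Cst.brw fun x => Pi Cst.brw fun y => Le x y ⇒ P ⬝ x ⇒ P ⬝ y ⇒ U j

/-- Induction hypothesis for the terms of a sequence `f`. -/
def hyp (P f : Exp) : Exp := Pi Cst.nat fun k => P ⬝ at' f k

/-- Induction hypothesis for the proofs that `f` is increasing. -/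
def hypIncr (Q pSucc f u : Exp) : Exp :=
  Pi Cst.nat fun k =>
    Q ⬝ (Cst.bsucc ⬝ at' f k) ⬝ at' f (Cst.suc ⬝ k) ⬝ incr f k
      ⬝ (pSucc ⬝ at' f k ⬝ (u ⬝ k)) ⬝ (u ⬝ (Cst.suc ⬝ k))

/-- Induction hypothesis for a simulation of `f` by `g`. -/
def hypSim (Q f g u v : Exp) : Exp :=
  Pi Cst.nat fun k => Ex Cst.nat fun n => Sigma (Le (at' f k) (at' g n)) fun l =>
    Q ⬝ at' f k ⬝ at' g n ⬝ l ⬝ (u ⬝ k) ⬝ (v ⬝ n)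

/-- Quantification over an increasing sequence together with its induction hypotheses. -/
def forallSeq (P Q pSucc : Exp) (B : Exp → Exp → Exp → Exp) : Exp :=
  Pi Incr fun f => Pi (hyp P f) fun u => Pi (hypIncr Q pSucc f u) fun w => B f u w

def tyZero (P : Exp) : Exp := P ⬝ Cst.bzero

def tySucc (P : Exp) : Exp := Pi Cst.brw fun x => P ⬝ x ⇒ P ⬝ (Cst.bsucc ⬝ x)

def tyLimit (P Q pSucc : Exp) : Exp :=
  forallSeq P Q pSucc fun f _ _ => P ⬝ (Cst.blimit ⬝ f)

/-- The two values at `limit f` and `limit g` are equal over the path `bisim f g r`. -/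
def tyBisim (P Q pSucc pLimit : Exp) : Exp :=
  forallSeq P Q pSucc fun f u w => forallSeq P Q pSucc fun g v z =>
    Pi (Bisim f g) fun r => hypSim Q f g u v ⇒ hypSim Q g f v u ⇒
      Eq (P ⬝ (Cst.blimit ⬝ g))
        (transport Cst.brw P (Cst.blimit ⬝ f) (Cst.blimit ⬝ g) (Cst.bisim ⬝ f ⬝ g ⬝ r)
          (pLimit ⬝ f ⬝ u ⬝ w))
        (pLimit ⬝ g ⬝ v ⬝ z)

def tySet (P : Exp) : Exp := Pi Cst.brw fun x => isSet (P ⬝ x)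

def tyLeZero (P Q pZero : Exp) : Exp :=
  Pi Cst.brw fun x => Pi (P ⬝ x) fun u => Q ⬝ Cst.bzero ⬝ x ⬝ (Cst.leZero ⬝ x) ⬝ pZero ⬝ u

def tyLeTrans (P Q : Exp) : Exp :=
  Pi Cst.brw fun x => Pi Cst.brw fun y => Pi Cst.brw fun z =>
  Pi (P ⬝ x) fun u => Pi (P ⬝ y) fun v => Pi (P ⬝ z) fun w =>
  Pi (Le x y) fun l => Pi (Le y z) fun m =>
    Q ⬝ x ⬝ y ⬝ l ⬝ u ⬝ v ⇒ Q ⬝ y ⬝ z ⬝ m ⬝ v ⬝ w ⇒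
      Q ⬝ x ⬝ z ⬝ (Cst.leTrans ⬝ x ⬝ y ⬝ z ⬝ l ⬝ m) ⬝ u ⬝ w

def tyLeSucc (P Q pSucc : Exp) : Exp :=
  Pi Cst.brw fun x => Pi Cst.brw fun y => Pi (P ⬝ x) fun u => Pi (P ⬝ y) fun v =>
  Pi (Le x y) fun l => Q ⬝ x ⬝ y ⬝ l ⬝ u ⬝ v ⇒
    Q ⬝ (Cst.bsucc ⬝ x) ⬝ (Cst.bsucc ⬝ y) ⬝ (Cst.leSuccMono ⬝ x ⬝ y ⬝ l)
      ⬝ (pSucc ⬝ x ⬝ u) ⬝ (pSucc ⬝ y ⬝ v)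

def tyLeCocone (P Q pSucc pLimit : Exp) : Exp :=
  Pi Cst.brw fun x => Pi (P ⬝ x) fun u => forallSeq P Q pSucc fun f v w =>
  Pi Cst.nat fun k => Pi (Le x (at' f k)) fun l => Q ⬝ x ⬝ at' f k ⬝ l ⬝ u ⬝ (v ⬝ k) ⇒
    Q ⬝ x ⬝ (Cst.blimit ⬝ f) ⬝ (Cst.leCocone ⬝ x ⬝ f ⬝ k ⬝ l) ⬝ u ⬝ (pLimit ⬝ f ⬝ v ⬝ w)

def tyLeLimiting (P Q pSucc pLimit : Exp) : Exp :=
  Pi Cst.brw fun x => Pi (P ⬝ x) fun u => forallSeq P Q pSucc fun f v w =>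
  Pi (Pi Cst.nat fun k => Le (at' f k) x) fun l =>
    (Pi Cst.nat fun k => Q ⬝ at' f k ⬝ x ⬝ (l ⬝ k) ⬝ (v ⬝ k) ⬝ u) ⇒
      Q ⬝ (Cst.blimit ⬝ f) ⬝ x ⬝ (Cst.leLimiting ⬝ x ⬝ f ⬝ l) ⬝ (pLimit ⬝ f ⬝ v ⬝ w) ⬝ u

def tyProp (P Q : Exp) : Exp :=
  Pi Cst.brw fun x => Pi Cst.brw fun y => Pi (Le x y) fun l => Pi (P ⬝ x) fun u =>
  Pi (P ⬝ y) fun v => isProp (Q ⬝ x ⬝ y ⬝ l ⬝ u ⬝ v)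

/-- Quantification over all motives of level `j` and their methods. -/
def forallAlg (j : ℕ) (B : Alg → Exp) : Exp :=
  Pi (tyP j) fun P => Pi (tyQ j P) fun Q =>
  Pi (tyZero P) fun pZero => Pi (tySucc P) fun pSucc => Pi (tyLimit P Q pSucc) fun pLimit =>
  Pi (tyBisim P Q pSucc pLimit) fun pBisim => Pi (tySet P) fun pSet =>
  Pi (tyLeZero P Q pZero) fun qZero => Pi (tyLeTrans P Q) fun qTrans =>
  Pi (tyLeSucc P Q pSucc) fun qSucc => Pi (tyLeCocone P Q pSucc pLimit) fun qCocone =>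
  Pi (tyLeLimiting P Q pSucc pLimit) fun qLimiting => Pi (tyProp P Q) fun qProp =>
    B ⟨P, Q, pZero, pSucc, pLimit, pBisim, pSet, qZero, qTrans, qSucc, qCocone, qLimiting, qProp⟩

/-- Abstraction over motives and methods. -/
def lamAlg (b : Alg → Exp) : Exp :=
  lam fun P => lam fun Q => lam fun pZero => lam fun pSucc => lam fun pLimit =>
  lam fun pBisim => lam fun pSet => lam fun qZero => lam fun qTrans => lam fun qSucc =>
  lam fun qCocone => lam fun qLimiting => lam fun qProp =>
    b ⟨P, Q, pZero, pSucc, pLimit, pBisim, pSet, qZero, qTrans, qSucc, qCocone, qLimiting, qProp⟩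

/-- Application of an eliminator to motives and methods. -/
def appAlg (c : Exp) (m : Alg) : Exp :=
  c ⬝ m.P ⬝ m.Q ⬝ m.pZero ⬝ m.pSucc ⬝ m.pLimit ⬝ m.pBisim ⬝ m.pSet
    ⬝ m.qZero ⬝ m.qTrans ⬝ m.qSucc ⬝ m.qCocone ⬝ m.qLimiting ⬝ m.qProp

/-- The function on Brouwer trees defined by induction. -/
def rec' (m : Alg) (x : Exp) : Exp := appAlg Cst.brwElim m ⬝ x

/-- The function on proofs of `x ≤ y` defined by induction. -/
def recLe (m : Alg) (x y l : Exp) : Exp := appAlg Cst.leElim m ⬝ x ⬝ y ⬝ l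

end Alg

/-! ## The types of the constants -/

/-- The type of each constant, at universe levels `i` (for its parameters) and `j` (for the
motive of an eliminator). -/
def Cst.ty (i j : ℕ) : Cst → Exp
  | empty => U 0
  | emptyElim => Pi (Cst.empty ⇒ U j) fun C => Pi Cst.empty fun x => C ⬝ x
  | unit => U 0
  | star => Cst.unit
  | unitElim => Pi (Cst.unit ⇒ U j) fun C => C ⬝ Cst.star ⇒ Pi Cst.unit fun x => C ⬝ x
  | bool => U 0
  | ff => Cst.bool
  | tt => Cst.bool
  | boolElim => Pi (Cst.bool ⇒ U j) fun C =>
      C ⬝ Cst.ff ⇒ C ⬝ Cst.tt ⇒ Pi Cst.bool fun x => C ⬝ x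
  | nat => U 0
  | zero => Cst.nat
  | suc => Cst.nat ⇒ Cst.nat
  | natElim => Pi (Cst.nat ⇒ U j) fun C =>
      C ⬝ Cst.zero ⇒ (Pi Cst.nat fun n => C ⬝ n ⇒ C ⬝ (Cst.suc ⬝ n)) ⇒
        Pi Cst.nat fun n => C ⬝ n
  | sum => U i ⇒ U i ⇒ U i
  | inl => Pi (U i) fun A => Pi (U i) fun B => A ⇒ Sum A B
  | inr => Pi (U i) fun A => Pi (U i) fun B => B ⇒ Sum A B
  | sumElim => Pi (U i) fun A => Pi (U i) fun B => Pi (Sum A B ⇒ U j) fun C =>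
      (Pi A fun a => C ⬝ (Cst.inl ⬝ A ⬝ B ⬝ a)) ⇒ (Pi B fun b => C ⬝ (Cst.inr ⬝ A ⬝ B ⬝ b)) ⇒
        Pi (Sum A B) fun x => C ⬝ x
  | sigma => Pi (U i) fun A => (A ⇒ U i) ⇒ U i
  | pair => Pi (U i) fun A => Pi (A ⇒ U i) fun B => Pi A fun a =>
      B ⬝ a ⇒ Cst.sigma ⬝ A ⬝ B
  | sigmaElim => Pi (U i) fun A => Pi (A ⇒ U i) fun B => Pi (Cst.sigma ⬝ A ⬝ B ⇒ U j) fun C =>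
      (Pi A fun a => Pi (B ⬝ a) fun b => C ⬝ (Cst.pair ⬝ A ⬝ B ⬝ a ⬝ b)) ⇒
        Pi (Cst.sigma ⬝ A ⬝ B) fun p => C ⬝ p
  | id => Pi (U i) fun A => A ⇒ A ⇒ U i
  | refl => Pi (U i) fun A => Pi A fun x => Eq A x x
  | idElim => Pi (U i) fun A =>
      Pi (Pi A fun x => Pi A fun y => Eq A x y ⇒ U j) fun C =>
        (Pi A fun x => C ⬝ x ⬝ x ⬝ (Cst.refl ⬝ A ⬝ x)) ⇒
          Pi A fun x => Pi A fun y => Pi (Eq A x y) fun p => C ⬝ x ⬝ y ⬝ p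
  | trunc => U i ⇒ U i
  | truncIn => Pi (U i) fun A => A ⇒ Cst.trunc ⬝ A
  | truncIsProp => Pi (U i) fun A => isProp (Cst.trunc ⬝ A)
  | truncElim => Pi (U i) fun A => Pi (Cst.trunc ⬝ A ⇒ U j) fun C =>
      (Pi (Cst.trunc ⬝ A) fun x => isProp (C ⬝ x)) ⇒
        (Pi A fun a => C ⬝ (Cst.truncIn ⬝ A ⬝ a)) ⇒ Pi (Cst.trunc ⬝ A) fun x => C ⬝ x
  | funext => Pi (U i) fun A => Pi (A ⇒ U i) fun B =>
      Pi (Pi A fun x => B ⬝ x) fun f => Pi (Pi A fun x => B ⬝ x) fun g =>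
        (Pi A fun x => Eq (B ⬝ x) (f ⬝ x) (g ⬝ x)) ⇒ Eq (Pi A fun x => B ⬝ x) f g
  | univalence => Pi (U i) fun A => Pi (U i) fun B =>
      isEquiv (Eq (U i) A B) (Equiv A B) (idToEquiv i A B)
  | brw => U 0
  | le => Cst.brw ⇒ Cst.brw ⇒ U 0
  | bzero => Cst.brw
  | bsucc => Cst.brw ⇒ Cst.brw
  | blimit => Incr ⇒ Cst.brw
  | bisim => Pi Incr fun f => Pi Incr fun g =>
      Bisim f g ⇒ Eq Cst.brw (Cst.blimit ⬝ f) (Cst.blimit ⬝ g)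
  | brwIsSet => isSet Cst.brw
  | leZero => Pi Cst.brw fun x => Le Cst.bzero x
  | leTrans => Pi Cst.brw fun x => Pi Cst.brw fun y => Pi Cst.brw fun z =>
      Le x y ⇒ Le y z ⇒ Le x z
  | leSuccMono => Pi Cst.brw fun x => Pi Cst.brw fun y =>
      Le x y ⇒ Le (Cst.bsucc ⬝ x) (Cst.bsucc ⬝ y)
  | leCocone => Pi Cst.brw fun x => Pi Incr fun f => Pi Cst.nat fun k =>
      Le x (at' f k) ⇒ Le x (Cst.blimit ⬝ f)
  | leLimiting => Pi Cst.brw fun x => Pi Incr fun f =>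
      (Pi Cst.nat fun k => Le (at' f k) x) ⇒ Le (Cst.blimit ⬝ f) x
  | leIsProp => Pi Cst.brw fun x => Pi Cst.brw fun y => isProp (Le x y)
  | brwElim => Alg.forallAlg j fun m => Pi Cst.brw fun x => m.P ⬝ x
  | leElim => Alg.forallAlg j fun m =>
      Pi Cst.brw fun x => Pi Cst.brw fun y => Pi (Le x y) fun l =>
        m.Q ⬝ x ⬝ y ⬝ l ⬝ m.rec' x ⬝ m.rec' y

/-! ## Computation rules, convertibility, typing -/

/-- The computation rules of the eliminators, as equations between closed terms. The eliminators
of the Brouwer trees compute on point constructors; the equations for the remaining constructors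
would be between elements of propositions, and hold up to the identity type. -/
inductive Comp : Exp → Exp → Prop
  | unit : Comp
      (lam fun C => lam fun c => Cst.unitElim ⬝ C ⬝ c ⬝ Cst.star)
      (lam fun _ => lam fun c => c)
  | ff : Comp
      (lam fun C => lam fun a => lam fun b => Cst.boolElim ⬝ C ⬝ a ⬝ b ⬝ Cst.ff)
      (lam fun _ => lam fun a => lam fun _ => a)
  | tt : Comp
      (lam fun C => lam fun a => lam fun b => Cst.boolElim ⬝ C ⬝ a ⬝ b ⬝ Cst.tt)
      (lam fun _ => lam fun _ => lam fun b => b)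
  | zero : Comp
      (lam fun C => lam fun a => lam fun s => Cst.natElim ⬝ C ⬝ a ⬝ s ⬝ Cst.zero)
      (lam fun _ => lam fun a => lam fun _ => a)
  | suc : Comp
      (lam fun C => lam fun a => lam fun s => lam fun n =>
        Cst.natElim ⬝ C ⬝ a ⬝ s ⬝ (Cst.suc ⬝ n))
      (lam fun C => lam fun a => lam fun s => lam fun n =>
        s ⬝ n ⬝ (Cst.natElim ⬝ C ⬝ a ⬝ s ⬝ n))
  | inl : Comp
      (lam fun A => lam fun B => lam fun C => lam fun l => lam fun r => lam fun a =>
        Cst.sumElim ⬝ A ⬝ B ⬝ C ⬝ l ⬝ r ⬝ (Cst.inl ⬝ A ⬝ B ⬝ a))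
      (lam fun _ => lam fun _ => lam fun _ => lam fun l => lam fun _ => lam fun a => l ⬝ a)
  | inr : Comp
      (lam fun A => lam fun B => lam fun C => lam fun l => lam fun r => lam fun b =>
        Cst.sumElim ⬝ A ⬝ B ⬝ C ⬝ l ⬝ r ⬝ (Cst.inr ⬝ A ⬝ B ⬝ b))
      (lam fun _ => lam fun _ => lam fun _ => lam fun _ => lam fun r => lam fun b => r ⬝ b)
  | pair : Comp
      (lam fun A => lam fun B => lam fun C => lam fun g => lam fun a => lam fun b =>
        Cst.sigmaElim ⬝ A ⬝ B ⬝ C ⬝ g ⬝ (Cst.pair ⬝ A ⬝ B ⬝ a ⬝ b))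
      (lam fun _ => lam fun _ => lam fun _ => lam fun g => lam fun a => lam fun b => g ⬝ a ⬝ b)
  | refl : Comp
      (lam fun A => lam fun C => lam fun c => lam fun x =>
        Cst.idElim ⬝ A ⬝ C ⬝ c ⬝ x ⬝ x ⬝ (Cst.refl ⬝ A ⬝ x))
      (lam fun _ => lam fun _ => lam fun c => lam fun x => c ⬝ x)
  | truncIn : Comp
      (lam fun A => lam fun C => lam fun h => lam fun g => lam fun a =>
        Cst.truncElim ⬝ A ⬝ C ⬝ h ⬝ g ⬝ (Cst.truncIn ⬝ A ⬝ a))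
      (lam fun _ => lam fun _ => lam fun _ => lam fun g => lam fun a => g ⬝ a)
  | bzero : Comp
      (Alg.lamAlg fun m => m.rec' Cst.bzero)
      (Alg.lamAlg fun m => m.pZero)
  | bsucc : Comp
      (Alg.lamAlg fun m => lam fun x => m.rec' (Cst.bsucc ⬝ x))
      (Alg.lamAlg fun m => lam fun x => m.pSucc ⬝ x ⬝ m.rec' x)
  | blimit : Comp
      (Alg.lamAlg fun m => lam fun f => m.rec' (Cst.blimit ⬝ f))
      (Alg.lamAlg fun m => lam fun f => m.pLimit ⬝ f
        ⬝ (lam fun k => m.rec' (at' f k))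
        ⬝ (lam fun k => m.recLe (Cst.bsucc ⬝ at' f k) (at' f (Cst.suc ⬝ k)) (incr f k)))

/-- Convertibility (definitional equality): the least congruence that contains the conversions
`β` and `η` for functions and the computation rules. -/
inductive Conv : Tm → Tm → Prop
  | refl (t : Tm) : Conv t t
  | symm {s t : Tm} : Conv s t → Conv t s
  | trans {s t u : Tm} : Conv s t → Conv t u → Conv s u
  | pi {A A' B B' : Tm} : Conv A A' → Conv B B' → Conv (.pi A B) (.pi A' B')
  | lam {b b' : Tm} : Conv b b' → Conv (.lam b) (.lam b')
  | app {f f' a a' : Tm} : Conv f f' → Conv a a' → Conv (.app f a) (.app f' a')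
  | beta (b a : Tm) : Conv (.app (.lam b) a) (b.inst a)
  | eta (f : Tm) : Conv (.lam (.app (f.shift 1) (.var 0))) f
  | comp {l r : Exp} : Comp l r → Conv l.closed r.closed

/-- The typing judgement `Γ ⊢ t : A`. The head of the list `Γ` is the type of the variable with
index `0`; each entry may refer to the entries after it. Starting from the empty context, only
contexts of well-formed types arise. -/
inductive HasType : List Tm → Tm → Tm → Prop
  | var {Γ : List Tm} {n : ℕ} {A : Tm} : Γ[n]? = some A → HasType Γ (.var n) (A.shift (n + 1))
  | univ {Γ : List Tm} (i : ℕ) : HasType Γ (.univ i) (.univ (i + 1))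
  | cumul {Γ : List Tm} {A : Tm} {i : ℕ} : HasType Γ A (.univ i) → HasType Γ A (.univ (i + 1))
  | pi {Γ : List Tm} {A B : Tm} {i : ℕ} :
      HasType Γ A (.univ i) → HasType (A :: Γ) B (.univ i) → HasType Γ (.pi A B) (.univ i)
  | lam {Γ : List Tm} {A B b : Tm} {i : ℕ} :
      HasType Γ A (.univ i) → HasType (A :: Γ) b B → HasType Γ (.lam b) (.pi A B)
  | app {Γ : List Tm} {A B f a : Tm} :
      HasType Γ f (.pi A B) → HasType Γ a A → HasType Γ (.app f a) (B.inst a)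
  | cst {Γ : List Tm} (c : Cst) (i j : ℕ) : HasType Γ (.cst c) (c.ty i j).closed
  | conv {Γ : List Tm} {t A B : Tm} {i : ℕ} :
      HasType Γ t A → Conv A B → HasType Γ B (.univ i) → HasType Γ t B

/-- The closed type `A` has an element in the type theory: this is what it means that the
statement `A` is proved. -/
def Provable (A : Exp) : Prop := ∃ t : Tm, HasType [] t A.closed

/-! ## The three statements -/

/-- The limited principle of omniscience: every binary sequence is constantly `ff`, or `tt`
somewhere. -/
def LPO : Exp :=
  Pi (Cst.nat ⇒ Cst.bool) fun s =>
    Sum (Pi Cst.nat fun n => Eq Cst.bool (s ⬝ n) Cst.ff)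
      (Ex Cst.nat fun n => Eq Cst.bool (s ⬝ n) Cst.tt)

/-- Trichotomy of `<` on Brouwer trees. -/
def Trichotomy : Exp :=
  Pi Cst.brw fun x => Pi Cst.brw fun y => Sum (Lt x y) (Sum (Eq Cst.brw x y) (Lt y x))

/-- Splitting of `≤` on Brouwer trees. -/
def Splitting : Exp :=
  Pi Cst.brw fun x => Pi Cst.brw fun y => Le x y ⇒ Sum (Lt x y) (Eq Cst.brw x y)

end HoTT

namespace HoTT

namespace Tm

/-! ## Renaming and substitution -/

/-! Derivability asks for explicit closed terms, so the proof has a metatheoretic half and a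
mathematical half. For the first, a bidirectional type checker with bounded recursion is written in
Lean and proved sound for `HasType` (`check_sound`). Only soundness matters: normalisation,
confluence and completeness play no role, since a failed or exhausted computation merely rejects a
term. The kernel runs the checker on terms assembled by combinators; lemmas of the object theory are
closed implications, joined by `Provable.mp`, so that earlier results enter later terms only as
variables.

The mathematical core is an encode-decode argument that characterises `<`. By recursion on `y` one
defines a proposition meaning "`x < y`": it is empty at zero, `x ≤ y` at a successor of `y`, and at
a limit of `f` it says that some `f k` already lies above `x`. Simulating sequences give equivalent
propositions, hence equal ones by univalence, so the recursion respects the path constructor. The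
resulting inversion principles (`ltInv`) yield irreflexivity and antisymmetry by induction.

From LPO to trichotomy: LPO extends to any sequence of decisions between `P n` and `Q n` (`altLPO`).
A double induction then decides `x < y` or `y ≤ x` (`dichotomy`), with LPO handling the limits, and
antisymmetry turns two such decisions into trichotomy. Irreflexivity gives splitting from
trichotomy.

From splitting to LPO (`lpo`): let `w` be the limit of the numerals, and let `v` be the limit of the
sequence that equals `k` while `s` has shown no `tt` before `k`, and `w + k` afterwards. Always `w ≤
v`. If `w < v`, some term exceeds `w`, so a `tt` has occurred; if `w = v`, no term exceeds `w`, so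
none ever occurs. -/

theorem upRen_comp (ρ ρ' : ℕ → ℕ) : upRen ρ' ∘ upRen ρ = upRen (ρ' ∘ ρ) := by
  funext n; cases n <;> rfl

theorem rename_rename (t : Tm) (ρ ρ' : ℕ → ℕ) :
    (t.rename ρ).rename ρ' = t.rename (ρ' ∘ ρ) := by
  induction t generalizing ρ ρ' with
  | var n => rfl
  | univ i => rfl
  | cst c => rfl
  | pi A B hA hB => simp only [rename, hA, hB, upRen_comp]
  | lam b hb => simp only [rename, hb, upRen_comp]
  | app f a hf ha => simp only [rename, hf, ha]

theorem upSub_upRen (σ : ℕ → Tm) (ρ : ℕ → ℕ) : upSub σ ∘ upRen ρ = upSub (σ ∘ ρ) := by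
  funext n; cases n <;> rfl

theorem subst_rename (t : Tm) (ρ : ℕ → ℕ) (σ : ℕ → Tm) :
    (t.rename ρ).subst σ = t.subst (σ ∘ ρ) := by
  induction t generalizing ρ σ with
  | var n => rfl
  | univ i => rfl
  | cst c => rfl
  | pi A B hA hB => simp only [rename, subst, hA, hB, upSub_upRen]
  | lam b hb => simp only [rename, subst, hb, upSub_upRen]
  | app f a hf ha => simp only [rename, subst, hf, ha]

theorem upSub_rename (σ : ℕ → Tm) (ρ : ℕ → ℕ) :
    (fun n => (upSub σ n).rename (upRen ρ)) = upSub (fun n => (σ n).rename ρ) := by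
  funext n
  cases n with
  | zero => rfl
  | succ n => simp only [upSub, shift, rename_rename]; rfl

theorem rename_subst (t : Tm) (σ : ℕ → Tm) (ρ : ℕ → ℕ) :
    (t.subst σ).rename ρ = t.subst (fun n => (σ n).rename ρ) := by
  induction t generalizing ρ σ with
  | var n => rfl
  | univ i => rfl
  | cst c => rfl
  | pi A B hA hB => simp only [rename, subst, hA, hB, upSub_rename]
  | lam b hb => simp only [rename, subst, hb, upSub_rename]
  | app f a hf ha => simp only [rename, subst, hf, ha]

theorem upSub_subst (σ τ : ℕ → Tm) :
    (fun n => (upSub σ n).subst (upSub τ)) = upSub (fun n => (σ n).subst τ) := by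
  funext n
  cases n with
  | zero => rfl
  | succ n => simp only [upSub, shift, subst_rename, rename_subst]; rfl

theorem subst_subst (t : Tm) (σ τ : ℕ → Tm) :
    (t.subst σ).subst τ = t.subst (fun n => (σ n).subst τ) := by
  induction t generalizing σ τ with
  | var n => rfl
  | univ i => rfl
  | cst c => rfl
  | pi A B hA hB => simp only [subst, hA, hB, upSub_subst]
  | lam b hb => simp only [subst, hb, upSub_subst]
  | app f a hf ha => simp only [subst, hf, ha]

theorem upSub_var : upSub var = var := by
  funext n; cases n <;> rfl

theorem subst_var (t : Tm) : t.subst var = t := by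
  induction t with
  | var n => rfl
  | univ i => rfl
  | cst c => rfl
  | pi A B hA hB => simp only [subst, hA, upSub_var, hB]
  | lam b hb => simp only [subst, upSub_var, hb]
  | app f a hf ha => simp only [subst, hf, ha]

theorem rename_eq_subst (t : Tm) (ρ : ℕ → ℕ) : t.rename ρ = t.subst (fun n => var (ρ n)) := by
  rw [← subst_var (t.rename ρ), subst_rename]; rfl

/-- The substitution of `a` for the last variable, followed by `σ` for the others. -/
def scons (a : Tm) (σ : ℕ → Tm) : ℕ → Tm
  | 0 => a
  | n + 1 => σ n

theorem inst_eq (b a : Tm) : b.inst a = b.subst (scons a var) := by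
  unfold inst
  congr 1

theorem shift_inst (t a : Tm) : (t.shift 1).inst a = t := by
  rw [inst_eq, shift, subst_rename]
  exact subst_var t

theorem upSub_inst (b a : Tm) (σ : ℕ → Tm) :
    (b.subst (upSub σ)).inst a = b.subst (scons a σ) := by
  rw [inst_eq, subst_subst]
  congr 1
  funext n
  cases n with
  | zero => rfl
  | succ n =>
    simp only [upSub, shift, subst_rename]
    exact subst_var _

theorem inst_subst (b a : Tm) (σ : ℕ → Tm) :
    (b.inst a).subst σ = (b.subst (upSub σ)).inst (a.subst σ) := by
  rw [upSub_inst, inst_eq, subst_subst]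
  congr 1
  funext n; cases n <;> rfl

theorem shift_subst_upSub (t : Tm) (σ : ℕ → Tm) :
    (t.shift 1).subst (upSub σ) = (t.subst σ).shift 1 := by
  simp only [shift, subst_rename, rename_subst]; rfl

theorem upSub_var_comp (ρ : ℕ → ℕ) : upSub (fun n => var (ρ n)) = fun n => var (upRen ρ n) := by
  funext n; cases n <;> rfl

theorem inst_rename (b a : Tm) (ρ : ℕ → ℕ) :
    (b.inst a).rename ρ = (b.rename (upRen ρ)).inst (a.rename ρ) := by
  simp only [rename_eq_subst, inst_subst, upSub_var_comp]

/-- All free variables of the term are below `k`. -/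
def closedAt : Tm → ℕ → Bool
  | var n, k => Nat.blt n k
  | univ _, _ => true
  | pi A B, k => A.closedAt k && B.closedAt (k + 1)
  | lam b, k => b.closedAt (k + 1)
  | app f a, k => f.closedAt k && a.closedAt k
  | cst _, _ => true

theorem subst_of_closedAt {t : Tm} {k : ℕ} {σ : ℕ → Tm} (h : t.closedAt k = true)
    (hσ : ∀ n < k, σ n = var n) : t.subst σ = t := by
  induction t generalizing k σ with
  | var n => exact hσ n (by simpa [closedAt] using h)
  | univ i => rfl
  | cst c => rfl
  | pi A B hA hB =>
    simp only [closedAt, Bool.and_eq_true] at h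
    simp only [subst]
    rw [hA h.1 hσ, hB h.2]
    intro n hn
    cases n with
    | zero => rfl
    | succ n => simp only [upSub, hσ n (by omega)]; rfl
  | lam b hb =>
    simp only [closedAt] at h
    simp only [subst]
    rw [hb h]
    intro n hn
    cases n with
    | zero => rfl
    | succ n => simp only [upSub, hσ n (by omega)]; rfl
  | app f a hf ha =>
    simp only [closedAt, Bool.and_eq_true] at h
    simp only [subst]
    rw [hf h.1 hσ, ha h.2 hσ]

theorem subst_of_closed {t : Tm} (h : t.closedAt 0 = true) (σ : ℕ → Tm) : t.subst σ = t :=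
  subst_of_closedAt h (by omega)

theorem rename_of_closed {t : Tm} (h : t.closedAt 0 = true) (ρ : ℕ → ℕ) : t.rename ρ = t := by
  rw [rename_eq_subst, subst_of_closed h]

end Tm

open Tm

/-- Closedness makes the rule for constants stable under every renaming and substitution; it is
found by computation, uniformly in the levels. -/
theorem Cst.ty_closedAt (c : Cst) (i j : ℕ) : (c.ty i j).closed.closedAt 0 = true := by
  cases c <;> rfl

theorem Comp.closedAt {l r : Exp} (h : Comp l r) :
    l.closed.closedAt 0 = true ∧ r.closed.closedAt 0 = true := by
  cases h <;> exact ⟨rfl, rfl⟩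

/-! ## Stability of conversion and typing under renaming and substitution -/

theorem Conv.subst {s t : Tm} (h : Conv s t) (σ : ℕ → Tm) : Conv (s.subst σ) (t.subst σ) := by
  induction h generalizing σ with
  | refl t => exact .refl _
  | symm _ h => exact (h σ).symm
  | trans _ _ h h' => exact (h σ).trans (h' σ)
  | pi _ _ h h' => exact .pi (h σ) (h' _)
  | lam _ h => exact .lam (h _)
  | app _ _ h h' => exact .app (h σ) (h' σ)
  | beta b a => rw [inst_subst]; exact .beta _ _
  | eta f =>
    simp only [Tm.subst, shift_subst_upSub, upSub]
    exact .eta _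
  | comp h => rw [subst_of_closed h.closedAt.1, subst_of_closed h.closedAt.2]; exact .comp h

theorem Conv.rename {s t : Tm} (h : Conv s t) (ρ : ℕ → ℕ) : Conv (s.rename ρ) (t.rename ρ) := by
  simp only [rename_eq_subst]; exact h.subst _

/-- `ρ` maps the variables of `Γ` to variables of `Δ` of the same types. -/
def RenOk (Γ Δ : List Tm) (ρ : ℕ → ℕ) : Prop :=
  ∀ n B, Γ[n]? = some B → ∃ C, Δ[ρ n]? = some C ∧ C.shift (ρ n + 1) = (B.shift (n + 1)).rename ρ

theorem RenOk.up {Γ Δ : List Tm} {ρ : ℕ → ℕ} (hρ : RenOk Γ Δ ρ) (A : Tm) :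
    RenOk (A :: Γ) (A.rename ρ :: Δ) (upRen ρ) := by
  intro n B hn
  cases n with
  | zero =>
    simp only [List.getElem?_cons_zero, Option.some.injEq] at hn
    subst hn
    refine ⟨A.rename ρ, rfl, ?_⟩
    simp only [shift, rename_rename]; rfl
  | succ n =>
    simp only [List.getElem?_cons_succ] at hn
    obtain ⟨C, hC, e⟩ := hρ n B hn
    refine ⟨C, by simpa [upRen] using hC, ?_⟩
    have := congrArg (Tm.shift 1) e
    simp only [shift, rename_rename] at this ⊢
    exact this

theorem HasType.rename {Γ Δ : List Tm} {t A : Tm} (h : HasType Γ t A) {ρ : ℕ → ℕ}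
    (hρ : RenOk Γ Δ ρ) : HasType Δ (t.rename ρ) (A.rename ρ) := by
  induction h generalizing Δ ρ with
  | var hn =>
    obtain ⟨C, hC, e⟩ := hρ _ _ hn
    rw [← e]; exact .var hC
  | univ i => exact .univ i
  | cumul _ h => exact .cumul (h hρ)
  | pi _ _ hA hB => exact .pi (hA hρ) (hB (hρ.up _))
  | lam _ _ hA hb => exact .lam (hA hρ) (hb (hρ.up _))
  | app _ _ hf ha => rw [inst_rename]; exact .app (hf hρ) (ha hρ)
  | cst c i j => rw [rename_of_closed (c.ty_closedAt i j)]; exact .cst c i j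
  | conv _ hc _ ht hB => exact .conv (ht hρ) (hc.rename ρ) (hB hρ)

theorem HasType.weaken {Γ : List Tm} {t A : Tm} (h : HasType Γ t A) (B : Tm) :
    HasType (B :: Γ) (t.shift 1) (A.shift 1) := by
  refine h.rename ?_
  intro n C hn
  refine ⟨C, by simpa using hn, ?_⟩
  simp only [shift, rename_rename]; rfl

/-- `σ` maps the variables of `Γ` to terms over `Δ` of the same types. -/
def SubOk (Γ Δ : List Tm) (σ : ℕ → Tm) : Prop :=
  ∀ n B, Γ[n]? = some B → HasType Δ (σ n) ((B.shift (n + 1)).subst σ)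

theorem SubOk.up {Γ Δ : List Tm} {σ : ℕ → Tm} (hσ : SubOk Γ Δ σ) (A : Tm) :
    SubOk (A :: Γ) (A.subst σ :: Δ) (upSub σ) := by
  intro n B hn
  cases n with
  | zero =>
    simp only [List.getElem?_cons_zero, Option.some.injEq] at hn
    subst hn
    rw [shift_subst_upSub]
    exact .var rfl
  | succ n =>
    simp only [List.getElem?_cons_succ] at hn
    have := (hσ n B hn).weaken (A.subst σ)
    rw [← shift_subst_upSub] at this
    simp only [shift, rename_rename] at this ⊢
    exact this

theorem HasType.subst {Γ Δ : List Tm} {t A : Tm} (h : HasType Γ t A) {σ : ℕ → Tm}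
    (hσ : SubOk Γ Δ σ) : HasType Δ (t.subst σ) (A.subst σ) := by
  induction h generalizing Δ σ with
  | var hn => exact hσ _ _ hn
  | univ i => exact .univ i
  | cumul _ h => exact .cumul (h hσ)
  | pi _ _ hA hB => exact .pi (hA hσ) (hB (hσ.up _))
  | lam _ _ hA hb => exact .lam (hA hσ) (hb (hσ.up _))
  | app _ _ hf ha => rw [inst_subst]; exact .app (hf hσ) (ha hσ)
  | cst c i j => rw [subst_of_closed (c.ty_closedAt i j)]; exact .cst c i j
  | conv _ hc _ ht hB => exact .conv (ht hσ) (hc.subst σ) (hB hσ)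

theorem HasType.inst {Γ : List Tm} {A B b a : Tm} (hb : HasType (A :: Γ) b B)
    (ha : HasType Γ a A) : HasType Γ (b.inst a) (B.inst a) := by
  rw [inst_eq, inst_eq]
  refine hb.subst ?_
  intro n C hn
  cases n with
  | zero =>
    simp only [List.getElem?_cons_zero, Option.some.injEq] at hn
    subst hn
    have := shift_inst A a
    rw [inst_eq] at this
    simpa only [scons, this] using ha
  | succ n =>
    simp only [List.getElem?_cons_succ] at hn
    have e : (C.shift (n + 1 + 1)).subst (scons a Tm.var) = C.shift (n + 1) := by
      have := shift_inst (C.shift (n + 1)) a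
      simp only [inst_eq, shift, rename_rename] at this
      exact this
    rw [e]
    exact .var hn

theorem HasType.cumul_le {Γ : List Tm} {A : Tm} {i k : ℕ} (h : HasType Γ A (.univ i))
    (hik : i ≤ k) : HasType Γ A (.univ k) := by
  induction hik with
  | refl => exact h
  | step _ ih => exact .cumul ih

/-- `A` is a type over `Γ`. -/
def IsTy (Γ : List Tm) (A : Tm) : Prop := ∃ i, HasType Γ A (.univ i)

theorem IsTy.univ (Γ : List Tm) (i : ℕ) : IsTy Γ (.univ i) := ⟨_, .univ i⟩

theorem IsTy.pi {Γ : List Tm} {A B : Tm} (hA : IsTy Γ A) (hB : IsTy (A :: Γ) B) :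
    IsTy Γ (.pi A B) := by
  obtain ⟨i, hA⟩ := hA
  obtain ⟨k, hB⟩ := hB
  exact ⟨max i k, .pi (hA.cumul_le (le_max_left _ _)) (hB.cumul_le (le_max_right _ _))⟩

/-- Besides the formation rule, only cumulativity and conversion can conclude a judgement about a
`pi` term, and both leave the term unchanged. -/
theorem HasType.of_pi {Γ : List Tm} {A B T : Tm} (h : HasType Γ (.pi A B) T) :
    IsTy Γ A ∧ IsTy (A :: Γ) B := by
  generalize ht : Tm.pi A B = t at h
  induction h with
  | pi hA hB => cases ht; exact ⟨⟨_, hA⟩, ⟨_, hB⟩⟩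
  | cumul _ ih => exact ih ht
  | conv _ _ _ ih _ => exact ih ht
  | _ => cases ht

theorem IsTy.of_pi {Γ : List Tm} {A B : Tm} (h : IsTy Γ (.pi A B)) :
    IsTy Γ A ∧ IsTy (A :: Γ) B := h.choose_spec.of_pi

theorem HasType.lam' {Γ : List Tm} {A B b : Tm} (hA : IsTy Γ A) (hb : HasType (A :: Γ) b B) :
    HasType Γ (.lam b) (.pi A B) := by
  obtain ⟨i, hA⟩ := hA
  exact .lam hA hb

theorem HasType.conv' {Γ : List Tm} {t A B : Tm} (ht : HasType Γ t A) (h : Conv A B)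
    (hB : IsTy Γ B) : HasType Γ t B := by
  obtain ⟨i, hB⟩ := hB
  exact .conv ht h hB

/-- All types of the context are types over the rest of the context. -/
def WfCtx (Γ : List Tm) : Prop := ∀ (n : ℕ) (A : Tm), Γ[n]? = some A → IsTy Γ (A.shift (n + 1))

theorem WfCtx.nil : WfCtx [] := by intro n A h; simp at h

theorem WfCtx.cons {Γ : List Tm} {A : Tm} (h : WfCtx Γ) (hA : IsTy Γ A) : WfCtx (A :: Γ) := by
  intro n B hn
  cases n with
  | zero =>
    simp only [List.getElem?_cons_zero, Option.some.injEq] at hn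
    subst hn
    obtain ⟨i, hA⟩ := hA
    exact ⟨i, hA.weaken A⟩
  | succ n =>
    simp only [List.getElem?_cons_succ] at hn
    obtain ⟨i, hB⟩ := h n B hn
    have := hB.weaken A
    simp only [shift, rename_rename] at this
    exact ⟨i, this⟩

theorem HasType.of_nil {Γ : List Tm} {t A : Tm} (h : HasType [] t A) : HasType Γ (t.rename id) (A.rename id) :=
  h.rename (by intro n B hn; simp at hn)

theorem IsTy.of_nil {Γ : List Tm} {A : Tm} (h : IsTy [] A) (hA : A.closedAt 0 = true) : IsTy Γ A := by
  obtain ⟨i, h⟩ := h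
  have := h.of_nil (Γ := Γ)
  rw [rename_of_closed hA] at this
  exact ⟨i, this⟩

end HoTT

namespace HoTT

/-! ## Evaluation of terms -/

namespace Tm

/-- Weakening by `k` of the variables from `c` on. -/
noncomputable def lift (k : ℕ) (t : Tm) : ℕ → Tm :=
  t.rec (fun n c => (Nat.blt n c).rec (var (n + k)) (var n)) (fun i _ => univ i)
    (fun _ _ A B c => pi (A c) (B (c + 1))) (fun _ b c => lam (b (c + 1)))
    (fun _ _ f a c => app (f c) (a c)) (fun c _ => cst c)

/-- Substitution of `a` for the variable `k`. -/
noncomputable def sub (a t : Tm) : ℕ → Tm :=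
  t.rec (fun n k => (Nat.blt n k).rec ((Nat.beq n k).rec (var (n - 1)) (a.lift k 0)) (var n))
    (fun i _ => univ i) (fun _ _ A B k => pi (A k) (B (k + 1))) (fun _ b k => lam (b (k + 1)))
    (fun _ _ f a k => app (f k) (a k)) (fun c _ => cst c)

@[simp] theorem lift_pi (k : ℕ) (A B : Tm) (c : ℕ) :
    (pi A B).lift k c = pi (A.lift k c) (B.lift k (c + 1)) := rfl

@[simp] theorem lift_lam (k : ℕ) (b : Tm) (c : ℕ) : (lam b).lift k c = lam (b.lift k (c + 1)) := rfl

@[simp] theorem lift_app (k : ℕ) (f a : Tm) (c : ℕ) :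
    (app f a).lift k c = app (f.lift k c) (a.lift k c) := rfl

/-- Connects the recursor form, used for evaluation, with `rename`, for which the substitution
calculus above is proved. -/
theorem lift_eq (k : ℕ) (t : Tm) (c : ℕ) :
    t.lift k c = t.rename (fun n => bif Nat.blt n c then n else n + k) := by
  induction t generalizing c with
  | var n => simp only [rename, lift]; cases Nat.blt n c <;> rfl
  | univ i => rfl
  | cst c => rfl
  | pi A B hA hB =>
    simp only [lift_pi, rename, hA, hB]
    congr 2; funext n
    cases n with
    | zero => rfl
    | succ n =>
      have : Nat.blt (n + 1) (c + 1) = Nat.blt n c := rfl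
      simp only [upRen, this]; cases Nat.blt n c
      · simp; omega
      · simp
  | lam b hb =>
    simp only [lift_lam, rename, hb]
    congr 2; funext n
    cases n with
    | zero => rfl
    | succ n =>
      have : Nat.blt (n + 1) (c + 1) = Nat.blt n c := rfl
      simp only [upRen, this]; cases Nat.blt n c
      · simp; omega
      · simp
  | app f a hf ha => simp only [lift_app, rename, hf, ha]

theorem lift_zero (k : ℕ) (t : Tm) : t.lift k 0 = t.shift k := lift_eq k t 0

/-- The substitution of `a` for the variable `k`. -/
def subAt (a : Tm) (k n : ℕ) : Tm :=
  bif Nat.blt n k then var n else bif Nat.beq n k then a.shift k else var (n - 1)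

theorem upSub_subAt (a : Tm) (k : ℕ) : upSub (subAt a k) = subAt a (k + 1) := by
  funext n
  cases n with
  | zero => rfl
  | succ n =>
    have h1 : Nat.blt (n + 1) (k + 1) = Nat.blt n k := rfl
    have h2 : Nat.beq (n + 1) (k + 1) = Nat.beq n k := rfl
    simp only [upSub, subAt, h1, h2]
    cases h : Nat.blt n k
    · cases h' : Nat.beq n k
      · have : n ≠ 0 := by
          rintro rfl
          cases k
          · cases h'
          · cases h
        obtain ⟨m, rfl⟩ := Nat.exists_eq_succ_of_ne_zero this
        rfl
      · simp only [cond_true, cond_false, shift, rename_rename]; rfl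
    · rfl

@[simp] theorem sub_pi (a A B : Tm) (k : ℕ) :
    sub a (pi A B) k = pi (sub a A k) (sub a B (k + 1)) := rfl

@[simp] theorem sub_lam (a b : Tm) (k : ℕ) : sub a (lam b) k = lam (sub a b (k + 1)) := rfl

@[simp] theorem sub_app (a f b : Tm) (k : ℕ) :
    sub a (app f b) k = app (sub a f k) (sub a b k) := rfl

theorem sub_eq (a t : Tm) (k : ℕ) : sub a t k = t.subst (subAt a k) := by
  induction t generalizing k with
  | var n =>
    simp only [sub, subst, subAt]
    cases Nat.blt n k
    · cases Nat.beq n k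
      · rfl
      · simp [lift_zero]
    · rfl
  | univ i => rfl
  | cst c => rfl
  | pi A B hA hB => simp only [sub_pi, subst, hA, hB, upSub_subAt]
  | lam b hb => simp only [sub_lam, subst, hb, upSub_subAt]
  | app f a hf ha => simp only [sub_app, subst, hf, ha]

theorem sub_zero (a t : Tm) : sub a t 0 = t.inst a := by
  rw [sub_eq, inst_eq]
  congr 1
  funext n
  cases n with
  | zero =>
    show a.shift 0 = a
    rw [shift, rename_eq_subst]; exact subst_var a
  | succ n => rfl

/-- Equality of terms. -/
noncomputable def beq (s : Tm) : Tm → Bool :=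
  s.rec
    (fun n t => t.casesOn (fun m => Nat.beq n m) (fun _ => false) (fun _ _ => false)
      (fun _ => false) (fun _ _ => false) (fun _ => false))
    (fun n t => t.casesOn (fun _ => false) (fun m => Nat.beq n m) (fun _ _ => false)
      (fun _ => false) (fun _ _ => false) (fun _ => false))
    (fun _ _ A B t => t.casesOn (fun _ => false) (fun _ => false) (fun A' B' => and (A A') (B B'))
      (fun _ => false) (fun _ _ => false) (fun _ => false))
    (fun _ b t => t.casesOn (fun _ => false) (fun _ => false) (fun _ _ => false)
      (fun b' => b b') (fun _ _ => false) (fun _ => false))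
    (fun _ _ f a t => t.casesOn (fun _ => false) (fun _ => false) (fun _ _ => false)
      (fun _ => false) (fun f' a' => and (f f') (a a')) (fun _ => false))
    (fun c t => t.casesOn (fun _ => false) (fun _ => false) (fun _ _ => false)
      (fun _ => false) (fun _ _ => false) (fun d => Nat.beq c.ctorIdx d.ctorIdx))

theorem _root_.HoTT.Cst.eq_of_ctorIdx {c c' : Cst} (h : c.ctorIdx = c'.ctorIdx) : c = c' := by
  rw [← Cst.ofNat_ctorIdx c, h, Cst.ofNat_ctorIdx]

theorem eq_of_beq {s t : Tm} (h : beq s t = true) : s = t := by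
  induction s generalizing t with
  | var n => cases t <;> first | exact congrArg var (Nat.eq_of_beq_eq_true h) | cases h
  | univ i => cases t <;> first | exact congrArg univ (Nat.eq_of_beq_eq_true h) | cases h
  | cst c =>
    cases t <;> first | exact congrArg cst (Cst.eq_of_ctorIdx (Nat.eq_of_beq_eq_true h)) | cases h
  | pi A B hA hB =>
    cases t <;> first
      | cases h
      | exact congrArg₂ pi (hA (Bool.and_eq_true_iff.1 h).1) (hB (Bool.and_eq_true_iff.1 h).2)
  | lam b hb => cases t <;> first | cases h | exact congrArg lam (hb h)
  | app f a hf ha =>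
    cases t <;> first
      | cases h
      | exact congrArg₂ app (hf (Bool.and_eq_true_iff.1 h).1) (ha (Bool.and_eq_true_iff.1 h).2)

end Tm
end HoTT

/-! ### Weak head normalisation and a conversion test -/

namespace HoTT

open Tm

namespace Tm

/-- Application to a list of arguments. -/
noncomputable def apps : Tm → List Tm → Tm
  | t, [] => t
  | t, a :: as => apps (app t a) as

/-- Application of iterated abstractions, in the environment `σ`, to a list of arguments. -/
noncomputable def evalLams : Tm → (ℕ → Tm) → List Tm → Tm
  | lam b, σ, a :: as => evalLams b (scons a σ) as
  | t, σ, as => apps (t.subst σ) as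

end Tm

theorem Conv.apps {s t : Tm} (h : Conv s t) (as : List Tm) : Conv (s.apps as) (t.apps as) := by
  induction as generalizing s t with
  | nil => exact h
  | cons a as ih => exact ih (.app h (.refl a))

/-- Each argument consumed is one `β` step; collecting the arguments in an environment performs a
single simultaneous substitution. -/
theorem conv_evalLams (t : Tm) (σ : ℕ → Tm) (as : List Tm) :
    Conv ((t.subst σ).apps as) (t.evalLams σ as) := by
  induction t generalizing σ as with
  | lam b hb =>
    cases as with
    | nil => exact .refl _
    | cons a as =>
      refine Conv.trans ?_ (hb (scons a σ) as)
      have := Conv.beta (b.subst (upSub σ)) a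
      rw [upSub_inst] at this
      exact this.apps as
  | _ => exact .refl _

/-- Computation rules are equations between closed abstractions; applying both sides to the same
arguments produces the instances that evaluation needs. -/
theorem Conv.of_comp {l r : Exp} (h : Comp l r) (as : List Tm) :
    Conv (l.closed.evalLams Tm.var as) (r.closed.evalLams Tm.var as) := by
  have hl := conv_evalLams l.closed Tm.var as
  have hr := conv_evalLams r.closed Tm.var as
  rw [subst_var] at hl hr
  exact hl.symm.trans (((Conv.comp h).apps as).trans hr)

/-- The right-hand side of the computation rule for limits. -/
noncomputable def limitRhs : Exp :=
  Alg.lamAlg fun m => HoTT.lam fun f => m.pLimit ⬝ f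
    ⬝ (HoTT.lam fun k => m.rec' (at' f k))
    ⬝ (HoTT.lam fun k => m.recLe (Cst.bsucc ⬝ at' f k) (at' f (Cst.suc ⬝ k)) (incr f k))

/-- One step of computation for a constant applied to a list of arguments: the new head and the
new arguments. Scrutinees are evaluated by `w`, and parameters compared by `cv`. -/
noncomputable def iota (w : Tm → Tm) (cv : Tm → Tm → Bool) : Cst → List Tm → Option (Tm × List Tm)
  | .unitElim, _ :: c :: x :: st =>
    match w x with
    | cst .star => some (c, st)
    | _ => none
  | .boolElim, _ :: a :: b :: x :: st =>
    match w x with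
    | cst .ff => some (a, st)
    | cst .tt => some (b, st)
    | _ => none
  | .natElim, C :: a :: s :: x :: st =>
    match w x with
    | cst .zero => some (a, st)
    | app (cst .suc) n =>
      some (s, n :: app (app (app (app (cst .natElim) C) a) s) n :: st)
    | _ => none
  | .sumElim, A :: B :: _ :: l :: r :: x :: st =>
    match w x with
    | app (app (app (cst .inl) A') B') a =>
      match and (cv A A') (cv B B') with
      | true => some (l, a :: st)
      | false => none
    | app (app (app (cst .inr) A') B') b =>
      match and (cv A A') (cv B B') with
      | true => some (r, b :: st)
      | false => none
    | _ => none
  | .sigmaElim, A :: B :: _ :: g :: x :: st =>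
    match w x with
    | app (app (app (app (cst .pair) A') B') a) b =>
      match and (cv A A') (cv B B') with
      | true => some (g, a :: b :: st)
      | false => none
    | _ => none
  | .idElim, A :: _ :: c :: x :: y :: p :: st =>
    match w p with
    | app (app (cst .refl) A') x' =>
      match and (cv A A') (and (cv x x') (cv y x')) with
      | true => some (c, x :: st)
      | false => none
    | _ => none
  | .truncElim, A :: _ :: _ :: g :: x :: st =>
    match w x with
    | app (app (cst .truncIn) A') a =>
      match cv A A' with
      | true => some (g, a :: st)
      | false => none
    | _ => none
  | .brwElim, P :: Q :: p1 :: p2 :: p3 :: p4 :: p5 :: q1 :: q2 :: q3 :: q4 :: q5 :: q6 :: x :: st =>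
    match w x with
    | cst .bzero => some (p1, st)
    | app (cst .bsucc) y =>
      some (p2, y :: apps (cst .brwElim) [P, Q, p1, p2, p3, p4, p5, q1, q2, q3, q4, q5, q6, y] :: st)
    | app (cst .blimit) f =>
      some (limitRhs.closed, P :: Q :: p1 :: p2 :: p3 :: p4 :: p5 :: q1 :: q2 :: q3 :: q4 :: q5 :: q6
        :: f :: st)
    | _ => none
  | _, _ => none

/-- The scrutinee is replaced by its weak head normal form. The parameters stored in its constructor
are then replaced by those of the eliminator, which `cv` has found convertible, because the rules
are stated with the same parameters in both places. -/
theorem iota_sound {w : Tm → Tm} {cv : Tm → Tm → Bool} (hw : ∀ t, Conv t (w t))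
    (hcv : ∀ s t, cv s t = true → Conv s t) {c : Cst} {st st' : List Tm} {r : Tm}
    (h : iota w cv c st = some (r, st')) : Conv ((cst c).apps st) (r.apps st') := by
  unfold iota at h
  split at h
  · rename_i C a x st
    have hx := hw x
    split at h <;> cases h
    rename_i e
    rw [e] at hx
    exact ((Conv.app (.refl _) hx).trans (Conv.of_comp .unit [C, r])).apps st'
  · rename_i C a b x st
    have hx := hw x
    split at h <;> cases h
    · rename_i e
      rw [e] at hx
      exact ((Conv.app (.refl _) hx).trans (Conv.of_comp .ff [C, r, b])).apps st'
    · rename_i e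
      rw [e] at hx
      exact ((Conv.app (.refl _) hx).trans (Conv.of_comp .tt [C, a, r])).apps st'
  · rename_i C a s x st
    have hx := hw x
    split at h <;> cases h
    · rename_i e
      rw [e] at hx
      exact ((Conv.app (.refl _) hx).trans (Conv.of_comp .zero [C, r, s])).apps st'
    · rename_i n e
      rw [e] at hx
      exact ((Conv.app (.refl _) hx).trans (Conv.of_comp .suc [C, a, r, n])).apps st
  · rename_i A B C l r x st
    have hx := hw x
    split at h
    · rename_i A' B' a e
      rw [e] at hx
      split at h <;> cases h
      rename_i hc
      simp only [Bool.and_eq_true] at hc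
      have hx := hx.trans (.app (.app (.app (.refl _) (hcv _ _ hc.1).symm) (hcv _ _ hc.2).symm) (.refl a))
      exact ((Conv.app (.refl _) hx).trans (Conv.of_comp .inl [A, B, C, _, r, a])).apps st
    · rename_i A' B' a e
      rw [e] at hx
      split at h <;> cases h
      rename_i hc
      simp only [Bool.and_eq_true] at hc
      have hx := hx.trans (.app (.app (.app (.refl _) (hcv _ _ hc.1).symm) (hcv _ _ hc.2).symm) (.refl a))
      exact ((Conv.app (.refl _) hx).trans (Conv.of_comp .inr [A, B, C, l, _, a])).apps st
    · cases h
  · rename_i A B C g x st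
    have hx := hw x
    split at h
    · rename_i A' B' a b e
      rw [e] at hx
      split at h <;> cases h
      rename_i hc
      simp only [Bool.and_eq_true] at hc
      have hx := hx.trans (.app (.app (.app (.app (.refl _) (hcv _ _ hc.1).symm) (hcv _ _ hc.2).symm)
        (.refl a)) (.refl b))
      exact ((Conv.app (.refl _) hx).trans (Conv.of_comp .pair [A, B, C, _, a, b])).apps st
    · cases h
  · rename_i A C c x y p st
    have hx := hw p
    split at h
    · rename_i A' x' e
      rw [e] at hx
      split at h <;> cases h
      rename_i hc
      simp only [Bool.and_eq_true] at hc
      -- The rule for `refl` needs identical endpoints, so both `x` and `y` are converted to the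
      -- point stored in the reflexivity proof.
      have hxx := hcv _ _ hc.2.1
      have hy := (hcv _ _ hc.2.2).trans hxx.symm
      have hx := hx.trans (.app (.app (.refl _) (hcv _ _ hc.1).symm) hxx.symm)
      exact ((Conv.app (.app (.refl _) hy) hx).trans (Conv.of_comp .refl [A, C, _, x])).apps st
    · cases h
  · rename_i A C k g x st
    have hx := hw x
    split at h
    · rename_i A' a e
      rw [e] at hx
      split at h <;> cases h
      rename_i hc
      have hx := hx.trans (.app (.app (.refl _) (hcv _ _ hc).symm) (.refl a))
      exact ((Conv.app (.refl _) hx).trans (Conv.of_comp .truncIn [A, C, k, _, a])).apps st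
    · cases h
  · rename_i P Q p1 p2 p3 p4 p5 q1 q2 q3 q4 q5 q6 x st
    have hx := hw x
    split at h <;> cases h
    · rename_i e
      rw [e] at hx
      exact ((Conv.app (.refl _) hx).trans
        (Conv.of_comp .bzero [P, Q, _, p2, p3, p4, p5, q1, q2, q3, q4, q5, q6])).apps st'
    · rename_i y e
      rw [e] at hx
      exact ((Conv.app (.refl _) hx).trans
        (Conv.of_comp .bsucc [P, Q, p1, _, p3, p4, p5, q1, q2, q3, q4, q5, q6, y])).apps st
    · rename_i f e
      rw [e] at hx
      -- For limits the new head is the whole unevaluated right-hand side, so it is matched with its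
      -- evaluated form before the rule applies.
      have h1 := Conv.of_comp .blimit [P, Q, p1, p2, p3, p4, p5, q1, q2, q3, q4, q5, q6, f]
      have h2 := conv_evalLams limitRhs.closed Tm.var [P, Q, p1, p2, p3, p4, p5, q1, q2, q3, q4, q5, q6, f]
      rw [subst_var] at h2
      exact ((Conv.app (.refl _) hx).trans (h1.trans h2.symm)).apps st
  · cases h

/-- Weak head normalisation of the application of a term to a list of arguments. -/
noncomputable def whnf (cv : Tm → Tm → Bool) : ℕ → Tm → List Tm → Tm
  | 0, t, st => t.apps st
  | n + 1, t, st =>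
    match t with
    | app f a => whnf cv n f (a :: st)
    | .lam b =>
      match st with
      | [] => .lam b
      | a :: st => whnf cv n (sub a b 0) st
    | cst c =>
      match iota (fun x => whnf cv n x []) cv c st with
      | some (r, st') => whnf cv n r st'
      | none => (cst c).apps st
    | t => t.apps st

/-- When the fuel runs out the current term is returned as it stands, so termination is irrelevant
to soundness. -/
theorem whnf_sound {cv : Tm → Tm → Bool} (hcv : ∀ s t, cv s t = true → Conv s t) (n : ℕ) (t : Tm)
    (st : List Tm) : Conv (t.apps st) (whnf cv n t st) := by
  induction n generalizing t st with
  | zero => exact .refl _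
  | succ n ih =>
    cases t with
    | app f a => exact ih f (a :: st)
    | lam b =>
      cases st with
      | nil => exact .refl _
      | cons a st =>
        refine ((Conv.beta b a).apps st).trans ?_
        rw [← Tm.sub_zero]
        exact ih (sub a b 0) st
    | cst c =>
      simp only [whnf]
      split
      · rename_i r st' h
        exact (iota_sound (fun x => ih x []) hcv h).trans (ih r st')
      · exact .refl _
    | _ => exact .refl _

/-- Comparison of terms up to conversion. -/
noncomputable def conv : ℕ → Tm → Tm → Bool
  | 0, s, t => beq s t
  | n + 1, s, t =>
    match beq s t with
    | true => true
    | false =>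
      match whnf (conv n) n s [], whnf (conv n) n t [] with
      | pi A B, pi A' B' => and (conv n A A') (conv n B B')
      | .lam b, .lam b' => conv n b b'
      | .lam b, t => conv n b (app (t.lift 1 0) (var 0))
      | s, .lam b => conv n (app (s.lift 1 0) (var 0)) b
      | app f a, app f' a' => and (conv n f f') (conv n a a')
      | s, t => beq s t

theorem conv_sound (n : ℕ) (s t : Tm) (h : conv n s t = true) : Conv s t := by
  induction n generalizing s t with
  | zero => rw [Tm.eq_of_beq h]; exact .refl _
  | succ n ih =>
    simp only [conv] at h
    split at h
    · rename_i e; rw [Tm.eq_of_beq e]; exact .refl _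
    · have hs := whnf_sound ih n s []
      have ht := whnf_sound ih n t []
      generalize whnf (conv n) n s [] = s' at *
      generalize whnf (conv n) n t [] = t' at *
      refine hs.trans (Conv.trans ?_ ht.symm)
      clear hs ht
      split at h
      · simp only [Bool.and_eq_true] at h
        exact .pi (ih _ _ h.1) (ih _ _ h.2)
      · exact .lam (ih _ _ h)
      -- Only one side is an abstraction: the other is `η`-expanded and the bodies are compared.
      · rw [lift_zero] at h
        exact (Conv.lam (ih _ _ h)).trans (.eta _)
      · rw [lift_zero] at h
        exact (Conv.eta _).symm.trans (Conv.lam (ih _ _ h))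
      · simp only [Bool.and_eq_true] at h
        exact .app (ih _ _ h.1) (ih _ _ h.2)
      · rw [Tm.eq_of_beq h]; exact .refl _

end HoTT

namespace HoTT

open Tm

/-! ## A type checker -/

/-- The normal form for the conversion `β`. -/
noncomputable def betaNf : ℕ → Tm → List Tm → Tm
  | 0, t, st => t.apps st
  | n + 1, t, st =>
    match t with
    | app f a => betaNf n f (a :: st)
    | .lam b =>
      match st with
      | [] => .lam (betaNf n b [])
      | a :: st => betaNf n (sub a b 0) st
    | pi A B => (pi (betaNf n A []) (betaNf n B [])).apps (st.map fun a => betaNf n a [])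
    | t => t.apps (st.map fun a => betaNf n a [])

theorem Conv.apps_map {f : Tm → Tm} (hf : ∀ t, Conv t (f t)) {s t : Tm} (h : Conv s t)
    (as : List Tm) : Conv (s.apps as) (t.apps (as.map f)) := by
  induction as generalizing s t with
  | nil => exact h
  | cons a as ih => exact ih (.app h (hf a))

theorem betaNf_sound (n : ℕ) (t : Tm) (st : List Tm) : Conv (t.apps st) (betaNf n t st) := by
  induction n generalizing t st with
  | zero => exact .refl _
  | succ n ih =>
    have hmap := fun t => ih t []
    cases t with
    | app f a => exact ih f (a :: st)
    | lam b =>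
      cases st with
      | nil => exact .lam (ih b [])
      | cons a st =>
        refine ((Conv.beta b a).apps st).trans ?_
        rw [← Tm.sub_zero]
        exact ih (sub a b 0) st
    | pi A B => exact Conv.apps_map hmap (.pi (ih A []) (ih B [])) st
    | _ => exact Conv.apps_map hmap (.refl _) st

/-- The number of unfoldings that evaluation may use. -/
noncomputable def depth : ℕ := 100000

/-- The universe levels at which the types of a constant are taken. -/
noncomputable def Cst.type : Cst → Tm
  -- Univalence is taken for `U 0`, which is an element of `univ 1`, the universe in which the
  -- parameters of the other constants are taken.
  | .univalence => (Cst.ty 0 1 .univalence).closed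
  | c => (c.ty 1 1).closed

/-- Comparison of types up to conversion and cumulativity. -/
noncomputable def subType (A B : Tm) : Bool :=
  match beq A B with
  | true => true
  | false =>
    match whnf (conv depth) depth A [], whnf (conv depth) depth B [] with
    | univ i, univ k => Nat.ble i k
    | A, B => conv depth A B

/-- The level of a universe. -/
noncomputable def level (A : Tm) : Option ℕ :=
  match whnf (conv depth) depth A [] with
  | univ i => some i
  | _ => none

/-- Type checking, for the constants allowed by `ok`. Without an expected type, the type is
inferred; the list contains arguments to which the term is going to be applied. -/
noncomputable def check (ok : Cst → Bool) : ℕ → List Tm → Tm → Option Tm → List Tm → Option Tm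
  | 0, _, _, _, _ => none
  | n + 1, Γ, t, some A, _ =>
    match t with
    | .lam b =>
      match A with
      | pi A B => check ok n (A :: Γ) b (some B) []
      | A =>
        match betaNf depth (whnf (conv depth) depth A []) [] with
        | pi A B =>
          match check ok n Γ (pi A B) none [] with
          | some _ => check ok n (A :: Γ) b (some B) []
          | none => none
        | _ => none
    | app (.lam b) a =>
      match check ok n Γ a none [] with
      | some A' => check ok n (A' :: Γ) b (some (A.lift 1 0)) []
      | none => none
    | t =>
      match check ok n Γ t none [] with
      | some A' =>
        match subType A' A with
        | true => some A
        | false => none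
      | none => none
  | n + 1, Γ, t, none, st =>
    match t with
    | var k =>
      match Γ[k]? with
      | some A => some (A.lift (k + 1) 0)
      | none => none
    | univ i => some (univ (i + 1))
    | pi A B =>
      match check ok n Γ A none [] with
      | some S =>
        match level S with
        | some i =>
          match check ok n (A :: Γ) B none [] with
          | some S =>
            match level S with
            | some k => some (univ (max i k))
            | none => none
          | none => none
        | none => none
      | none => none
    | cst c =>
      match ok c with
      | true => some c.type
      | false => none
    | .lam b =>
      match st with
      | [] => none
      | a :: st =>
        match check ok n Γ a none [] with
        | some A =>
          match check ok n (A :: Γ) b none (st.map fun a => a.lift 1 0) with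
          | some B => some (pi A B)
          | none => none
        | none => none
    | app (.lam b) a =>
      match check ok n Γ a none [] with
      | some A =>
        match check ok n (A :: Γ) b none (st.map fun a => a.lift 1 0) with
        | some B => some (sub a B 0)
        | none => none
      | none => none
    | app (cst .trunc) A =>
      match check ok n Γ A none [] with
      | some S =>
        match level S with
        | some i => some (univ i)
        | none => none
      | none => none
    | app (app (cst .sum) A) B =>
      match check ok n Γ A none [] with
      | some S =>
        match level S with
        | some i =>
          match check ok n Γ B none [] with
          | some S =>
            match level S with
            | some k => some (univ (max i k))
            | none => none
          | none => none
        | none => none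
      | none => none
    | app (app (cst .sigma) A) (.lam B) =>
      match check ok n Γ A none [] with
      | some S =>
        match level S with
        | some i =>
          match check ok n (A :: Γ) B none [] with
          | some S =>
            match level S with
            | some k => some (univ (max i k))
            | none => none
          | none => none
        | none => none
      | none => none
    | app (app (app (cst .id) A) x) y =>
      match check ok n Γ A none [] with
      | some S =>
        match level S with
        | some i =>
          match check ok n Γ x (some A) [] with
          | some _ =>
            match check ok n Γ y (some A) [] with
            | some _ => some (univ i)
            | none => none
          | none => none
        | none => none
      | none => none
    | app f a =>
      match check ok n Γ f none (a :: st) with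
      | some (pi A B) =>
        match check ok n Γ a (some A) [] with
        | some _ => some (sub a B 0)
        | none => none
      | some F =>
        match betaNf depth (whnf (conv depth) depth F []) [] with
        | pi A B =>
          match check ok n Γ (pi A B) none [] with
          | some _ =>
            match check ok n Γ a (some A) [] with
            | some _ => some (sub a B 0)
            | none => none
          | none => none
        | _ => none
      | none => none

theorem level_sound {A : Tm} {i : ℕ} (h : level A = some i) : Conv A (univ i) := by
  unfold level at h
  have := whnf_sound (conv_sound depth) depth A []
  split at h
  · rename_i e
    rw [e] at this
    cases h
    exact this
  · cases h

theorem subType_sound {Γ : List Tm} {t A B : Tm} (h : subType A B = true) (ht : HasType Γ t A)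
    (hB : IsTy Γ B) : HasType Γ t B := by
  unfold subType at h
  split at h
  · rename_i e; rw [← Tm.eq_of_beq e]; exact ht
  · have hA' := whnf_sound (conv_sound depth) depth A []
    have hB' := whnf_sound (conv_sound depth) depth B []
    split at h
    · rename_i i k eA eB
      rw [eA] at hA'
      rw [eB] at hB'
      exact ((ht.conv' hA' (.univ _ _)).cumul_le (Nat.le_of_ble_eq_true h)).conv' hB'.symm hB
    · exact ht.conv' (hA'.trans ((conv_sound _ _ _ h).trans hB'.symm)) hB

/-- The types of the constants allowed by `ok` are closed types. -/
noncomputable def OkTypes (ok : Cst → Bool) : Prop := ∀ c, ok c = true → IsTy [] c.type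

theorem Cst.hasType_type (Γ : List Tm) (c : Cst) : HasType Γ (cst c) c.type := by
  cases c
  all_goals exact .cst _ _ _

theorem Cst.type_closedAt (c : Cst) : c.type.closedAt 0 = true := by
  cases c
  all_goals exact Cst.ty_closedAt _ _ _

theorem nf_sound (F : Tm) : Conv F (betaNf depth (whnf (conv depth) depth F []) []) :=
  (whnf_sound (conv_sound depth) depth F []).trans (betaNf_sound depth _ [])

/-- Since `Cst.type` fixes the levels of the constants, the type formers get their own rules, which
place the type formed at the level of its arguments. This keeps small types in `univ 0`. -/
theorem hasType_trunc {Γ : List Tm} {A : Tm} {i : ℕ} (hA : HasType Γ A (univ i)) :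
    HasType Γ (app (cst .trunc) A) (univ i) :=
  .app (B := univ i) (.cst .trunc i i) hA

theorem hasType_sum {Γ : List Tm} {A B : Tm} {i k : ℕ} (hA : HasType Γ A (univ i))
    (hB : HasType Γ B (univ k)) : HasType Γ (app (app (cst .sum) A) B) (univ (max i k)) :=
  .app (B := univ (max i k)) (.app (B := .pi (univ (max i k)) (univ (max i k)))
    (.cst .sum (max i k) 0) (hA.cumul_le (le_max_left _ _))) (hB.cumul_le (le_max_right _ _))

theorem hasType_sigma {Γ : List Tm} {A B : Tm} {i k : ℕ} (hA : HasType Γ A (univ i))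
    (hB : HasType (A :: Γ) B (univ k)) :
    HasType Γ (app (app (cst .sigma) A) (.lam B)) (univ (max i k)) := by
  have hA := hA.cumul_le (le_max_left i k)
  exact .app (B := univ (max i k)) (.app (B := .pi (.pi (var 0) (univ (max i k))) (univ (max i k)))
    (.cst .sigma (max i k) 0) hA) (.lam hA (hB.cumul_le (le_max_right _ _)))

theorem hasType_id {Γ : List Tm} {A x y : Tm} {i : ℕ} (hA : HasType Γ A (univ i))
    (hx : HasType Γ x A) (hy : HasType Γ y A) :
    HasType Γ (app (app (app (cst .id) A) x) y) (univ i) := by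
  have h1 : HasType Γ (app (cst .id) A) (.pi A (.pi (A.shift 1) (univ i))) :=
    .app (B := .pi (var 0) (.pi (var 1) (univ i))) (.cst .id i 0) hA
  have h2 : HasType Γ (app (app (cst .id) A) x) (.pi ((A.shift 1).inst x) (univ i)) := .app h1 hx
  rw [shift_inst] at h2
  exact .app h2 hy

/-- Inference and checking are proved sound together by induction on the fuel. The invariants are
that the context is well formed and that the expected type is a type; inference returns the latter
property along with the judgement. -/
theorem check_sound {ok : Cst → Bool} (hok : OkTypes ok) (n : ℕ) {Γ : List Tm} (hΓ : WfCtx Γ)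
    (t : Tm) :
    (∀ st A, check ok n Γ t none st = some A → HasType Γ t A ∧ IsTy Γ A) ∧
    (∀ A A', IsTy Γ A → check ok n Γ t (some A) [] = some A' → HasType Γ t A) := by
  induction n generalizing Γ t with
  | zero => exact ⟨fun st A h => (nomatch h), fun A A' _ h => (nomatch h)⟩
  | succ n ih =>
    have inf : ∀ {Γ t st A}, WfCtx Γ → check ok n Γ t none st = some A →
        HasType Γ t A ∧ IsTy Γ A := fun hΓ h => (ih hΓ _).1 _ _ h
    have chk : ∀ {Γ t A A'}, WfCtx Γ → IsTy Γ A → check ok n Γ t (some A) [] = some A' →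
        HasType Γ t A := fun hΓ hA h => (ih hΓ _).2 _ _ hA h
    have sort : ∀ {Γ A S}, WfCtx Γ → check ok n Γ A none [] = some S → ∀ {i}, level S = some i →
        HasType Γ A (univ i) := fun hΓ h _ hi =>
      (inf hΓ h).1.conv' (level_sound hi) (.univ _ _)
    -- Subject reduction is not proved, so a function type obtained by normalising is itself checked
    -- before its domain and codomain are used.
    have isPi : ∀ {Γ A B S}, WfCtx Γ → check ok n Γ (pi A B) none [] = some S →
        IsTy Γ A ∧ IsTy (A :: Γ) B := fun hΓ h => (inf hΓ h).1.of_pi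
    refine ⟨fun st A h => ?_, fun A A' hA h => ?_⟩
    · unfold check at h
      split at h
      · split at h <;> cases h
        rename_i e
        rw [lift_zero]
        exact ⟨.var e, hΓ _ _ e⟩
      · cases h; exact ⟨.univ _, .univ _ _⟩
      · repeat' split at h
        all_goals cases h
        rename_i h1 _ _ e1 _ _ h2 _ _ e2
        have hA := sort hΓ h1 e1
        have hB := sort (hΓ.cons ⟨_, hA⟩) h2 e2
        exact ⟨.pi (hA.cumul_le (le_max_left _ _)) (hB.cumul_le (le_max_right _ _)), .univ _ _⟩
      · split at h <;> cases h
        rename_i e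
        exact ⟨Cst.hasType_type _ _, (hok _ e).of_nil (Cst.type_closedAt _)⟩
      · repeat' split at h
        all_goals cases h
        rename_i h1 _ _ h2
        obtain ⟨_, hA⟩ := inf hΓ h1
        obtain ⟨hb, hB⟩ := inf (hΓ.cons hA) h2
        exact ⟨.lam' hA hb, hA.pi hB⟩
      · repeat' split at h
        all_goals cases h
        rename_i h1 _ _ h2
        obtain ⟨ha, hA⟩ := inf hΓ h1
        obtain ⟨hb, i, hB⟩ := inf (hΓ.cons hA) h2
        rw [Tm.sub_zero]
        exact ⟨.app (.lam' hA hb) ha, _, hB.inst ha⟩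
      · repeat' split at h
        all_goals cases h
        rename_i h1 _ _ e1
        exact ⟨hasType_trunc (sort hΓ h1 e1), .univ _ _⟩
      · repeat' split at h
        all_goals cases h
        rename_i h1 _ _ e1 _ _ h2 _ _ e2
        exact ⟨hasType_sum (sort hΓ h1 e1) (sort hΓ h2 e2), .univ _ _⟩
      · repeat' split at h
        all_goals cases h
        rename_i h1 _ _ e1 _ _ h2 _ _ e2
        have hA := sort hΓ h1 e1
        exact ⟨hasType_sigma hA (sort (hΓ.cons ⟨_, hA⟩) h2 e2), .univ _ _⟩
      · repeat' split at h
        all_goals cases h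
        rename_i h1 _ _ e1 _ _ hx _ _ hy
        have hA := sort hΓ h1 e1
        exact ⟨hasType_id hA (chk hΓ ⟨_, hA⟩ hx) (chk hΓ ⟨_, hA⟩ hy), .univ _ _⟩
      · split at h
        · rename_i h1
          split at h <;> cases h
          rename_i h2
          obtain ⟨hf, hF⟩ := inf hΓ h1
          have ha := chk hΓ hF.of_pi.1 h2
          obtain ⟨i, hB⟩ := hF.of_pi.2
          rw [Tm.sub_zero]
          exact ⟨.app hf ha, _, hB.inst ha⟩
        · rename_i F _ h1
          have hF := nf_sound F
          split at h
          · rename_i e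
            rw [e] at hF
            repeat' split at h
            all_goals cases h
            rename_i h2 _ _ h3
            obtain ⟨hA, hB⟩ := isPi hΓ h2
            have hf := (inf hΓ h1).1.conv' hF (hA.pi hB)
            have ha := chk hΓ hA h3
            obtain ⟨i, hB⟩ := hB
            rw [Tm.sub_zero]
            exact ⟨.app hf ha, _, hB.inst ha⟩
          · cases h
        · cases h
    · unfold check at h
      split at h
      · split at h
        · obtain ⟨hA, hB⟩ := hA.of_pi
          exact .lam' hA (chk (hΓ.cons hA) hB h)
        · have hF := nf_sound A
          split at h
          · rename_i e
            rw [e] at hF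
            split at h
            · rename_i h2
              obtain ⟨hA', hB⟩ := isPi hΓ h2
              exact (HasType.lam' hA' (chk (hΓ.cons hA') hB h)).conv' hF.symm hA
            · cases h
          · cases h
      · split at h
        · rename_i A₀ h1
          obtain ⟨ha, hA'⟩ := inf hΓ h1
          -- A redex acts as a local lemma: its body is checked against the weakened expected type,
          -- and instantiation undoes the weakening.
          have hA1 : IsTy (A₀ :: Γ) (A.shift 1) := ⟨_, hA.choose_spec.weaken _⟩
          rw [lift_zero] at h
          have := HasType.app (.lam' hA' (chk (hΓ.cons hA') hA1 h)) ha
          rwa [shift_inst] at this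
        · cases h
      · split at h
        · rename_i h1
          split at h <;> cases h
          rename_i e
          exact subType_sound e (inf hΓ h1).1 hA
        · cases h

/-- The type of every constant is checked with the constants that come before it. -/
theorem check_type : (List.range (Cst.leElim.ctorIdx + 1)).all (fun k =>
    (check (fun c' => Nat.blt c'.ctorIdx k) 1000 [] (Cst.ofNat k).type none []).any
      fun S => (level S).isSome) = true := by
  decide +kernel

/-- Soundness of the checker presupposes well-formed types for the permitted constants. Strong
induction along the order of declaration removes the circularity, since each type mentions only
earlier constants. -/
theorem Cst.isTy_type (c : Cst) : IsTy [] c.type := by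
  induction hk : c.ctorIdx using Nat.strong_induction_on generalizing c with
  | _ k ih =>
    have hlt : k < Cst.leElim.ctorIdx + 1 := by
      rw [← hk]; cases c <;> decide
    have h := List.all_eq_true.1 check_type k (List.mem_range.2 hlt)
    rw [← hk, Cst.ofNat_ctorIdx] at h
    simp only [Option.any_eq_true, Option.isSome_iff_exists] at h
    obtain ⟨S, hS, i, hi⟩ := h
    have hok : OkTypes (fun c' => Nat.blt c'.ctorIdx c.ctorIdx) := by
      intro c' hc'
      refine ih c'.ctorIdx ?_ c' rfl
      simpa [hk] using hc'
    exact ⟨i, ((check_sound hok _ WfCtx.nil _).1 _ _ hS).1.conv' (level_sound hi) (.univ _ _)⟩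

/-- The closed terms `t` and `A` are accepted as an element and its type. -/
noncomputable def accepts (t A : Tm) : Bool :=
  match check (fun _ => true) depth [] A none [] with
  | some S =>
    match level S with
    | some _ => (check (fun _ => true) depth [] t (some A) []).isSome
    | none => false
  | none => false

theorem hasType_of_accepts {t A : Tm} (h : accepts t A = true) : HasType [] t A := by
  unfold accepts at h
  have hok : OkTypes fun _ => true := fun c _ => c.isTy_type
  split at h
  · rename_i hS
    split at h
    · rename_i i hi
      obtain ⟨A', h⟩ := Option.isSome_iff_exists.1 h
      exact (check_sound hok _ .nil t).2 A A' ⟨i, ((check_sound hok _ .nil _).1 _ _ hS).1.conv'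
        (level_sound hi) (.univ _ _)⟩ h
    · cases h
  · cases h

/-- From `A ⇒ B` and `A`, for a closed type `B`. -/
theorem Provable.mp {A B : Exp} (h : Provable (A ⇒ B)) (hA : Provable A)
    (hB : and (beq (B 1) (B 0)) ((B 0).closedAt 0) = true := by decide +kernel) : Provable B := by
  obtain ⟨f, hf⟩ := h
  obtain ⟨a, ha⟩ := hA
  simp only [Bool.and_eq_true] at hB
  refine ⟨.app f a, ?_⟩
  have := HasType.app (B := B 1) hf ha
  rwa [Tm.eq_of_beq hB.1, inst_eq, subst_of_closed hB.2] at this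

end HoTT

namespace HoTT

/-! ## Terms annotated with their types

The annotation lets Lean infer the implicit arguments of the constants; it is not trusted, but
checked by `accepts`. -/

/-- A term that is meant to be an element of `A`. -/
structure Tr (A : Exp) where
  e : Exp

namespace Tr

instance {A : Exp} : CoeOut (Tr A) Exp := ⟨Tr.e⟩

instance {A : ℕ → Tm} : CoeOut (Tr A) Exp := ⟨Tr.e⟩

/-- All trust rests on the kernel's evaluation of `accepts` on the underlying raw term; the
annotation only supplies the type to check against. -/
theorem provable {A : Exp} (t : Tr A) (h : accepts (t.e 0) (A 0) = true := by decide +kernel) :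
    Provable A :=
  ⟨_, hasType_of_accepts h⟩

variable {A B C : Exp} {F : Exp → Exp}

/-- Change of the type along a conversion. -/
def cast (a : Tr A) : Tr B := ⟨a.e⟩

/-- An element of `A`, used at a convertible type. -/
def of (A : Exp) (a : Tr A) : Tr B := ⟨a.e⟩

def lam (b : (x : Tr A) → Tr (F x)) : Tr (Pi A F) := ⟨HoTT.lam fun x => (b ⟨x⟩).e⟩

def ap (f : Tr (Pi A F)) (a : Tr A) : Tr (F a) := ⟨f.e ⬝ a⟩

infixl:70 " ⬩ " => Tr.ap

/-- A term with its type; it computes to the term. -/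
def ann (a : Tr A) : Tr A := ⟨Cst.unitElim ⬝ (HoTT.lam fun _ => A) ⬝ a ⬝ Cst.star⟩

/-- A local lemma. -/
def have' (a : Tr A) (b : Tr A → Tr B) : Tr B := ⟨HoTT.lam (fun x => (b ⟨x⟩).e) ⬝ (ann a).e⟩

/-! ### Identity types -/

def refl {x : Exp} : Tr (Eq A x x) := ⟨Cst.refl ⬝ A ⬝ x⟩

/-- Path induction. -/
def J (D : (x y : Tr A) → Tr (Eq A x y) → Exp) (c : (x : Tr A) → Tr (D x x refl)) {x y : Exp}
    (p : Tr (Eq A x y)) : Tr (D ⟨x⟩ ⟨y⟩ p) :=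
  ⟨Cst.idElim ⬝ A ⬝ (HoTT.lam fun x => HoTT.lam fun y => HoTT.lam fun p => D ⟨x⟩ ⟨y⟩ ⟨p⟩)
    ⬝ (HoTT.lam fun x => (c ⟨x⟩).e) ⬝ x ⬝ y ⬝ p⟩

def symm {x y : Exp} (p : Tr (Eq A x y)) : Tr (Eq A y x) :=
  J (fun x y _ => Eq A y x) (fun _ => refl) p

def trans {x y z : Exp} (p : Tr (Eq A x y)) (q : Tr (Eq A y z)) : Tr (Eq A x z) :=
  J (fun x y _ => Eq A y z ⇒ Eq A x z) (fun _ => lam fun q => q) p ⬩ q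

def cong (f : Tr A → Tr B) {x y : Exp} (p : Tr (Eq A x y)) : Tr (Eq B (f ⟨x⟩) (f ⟨y⟩)) :=
  J (fun x y _ => Eq B (f x) (f y)) (fun _ => refl) p

def subst (P : Tr A → Exp) {x y : Exp} (p : Tr (Eq A x y)) (u : Tr (P ⟨x⟩)) : Tr (P ⟨y⟩) :=
  J (fun x y _ => P x ⇒ P y) (fun _ => lam fun u => u) p ⬩ u

def funext {f g : Exp} (h : Tr (Pi A fun x => Eq (F x) (f ⬝ x) (g ⬝ x))) : Tr (Eq (Pi A F) f g) :=
  ⟨Cst.funext ⬝ A ⬝ HoTT.lam F ⬝ f ⬝ g ⬝ h⟩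

/-! ### Dependent pairs -/

def pair (a : Tr A) (b : Tr (F a)) : Tr (Sigma A F) := ⟨mkPair A F a b⟩

def prodMk (a : Tr A) (b : Tr B) : Tr (Prod A B) := pair (F := fun _ => B) a b

def fst (p : Tr (Sigma A F)) : Tr A := ⟨HoTT.fst A F p⟩

def snd (p : Tr (Sigma A F)) : Tr (F p.fst) := ⟨HoTT.snd A F p⟩

def sigmaElim (p : Tr (Sigma A F)) (D : Tr (Sigma A F) → Exp)
    (g : (a : Tr A) → (b : Tr (F a)) → Tr (D (pair a b))) : Tr (D p) :=
  ⟨Cst.sigmaElim ⬝ A ⬝ HoTT.lam F ⬝ (HoTT.lam fun p => D ⟨p⟩)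
    ⬝ (HoTT.lam fun a => HoTT.lam fun b => (g ⟨a⟩ ⟨b⟩).e) ⬝ p⟩

/-! ### Finite types, natural numbers, sums -/

def absurd (x : Tr Cst.empty) : Tr C := ⟨Cst.emptyElim ⬝ (HoTT.lam fun _ => C) ⬝ x⟩

def star : Tr Cst.unit := ⟨Cst.star⟩

def unitElim (x : Tr Cst.unit) (D : Tr Cst.unit → Exp) (c : Tr (D star)) : Tr (D x) :=
  ⟨Cst.unitElim ⬝ (HoTT.lam fun x => D ⟨x⟩) ⬝ c ⬝ x⟩

def ff : Tr Cst.bool := ⟨Cst.ff⟩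

def tt : Tr Cst.bool := ⟨Cst.tt⟩

def boolElim (x : Tr Cst.bool) (D : Tr Cst.bool → Exp) (a : Tr (D ff)) (b : Tr (D tt)) :
    Tr (D x) :=
  ⟨Cst.boolElim ⬝ (HoTT.lam fun x => D ⟨x⟩) ⬝ a ⬝ b ⬝ x⟩

def zero : Tr Cst.nat := ⟨Cst.zero⟩

def suc (n : Tr Cst.nat) : Tr Cst.nat := ⟨Cst.suc ⬝ n⟩

def natElim (n : Tr Cst.nat) (D : Tr Cst.nat → Exp) (a : Tr (D zero))
    (s : (n : Tr Cst.nat) → Tr (D n) → Tr (D (suc n))) : Tr (D n) :=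
  ⟨Cst.natElim ⬝ (HoTT.lam fun x => D ⟨x⟩) ⬝ a
    ⬝ (HoTT.lam fun n => HoTT.lam fun h => (s ⟨n⟩ ⟨h⟩).e) ⬝ n⟩

def inl (a : Tr A) : Tr (Sum A B) := ⟨Cst.inl ⬝ A ⬝ B ⬝ a⟩

def inr (b : Tr B) : Tr (Sum A B) := ⟨Cst.inr ⬝ A ⬝ B ⬝ b⟩

def sumElim (x : Tr (Sum A B)) (D : Tr (Sum A B) → Exp) (l : (a : Tr A) → Tr (D (inl a)))
    (r : (b : Tr B) → Tr (D (inr b))) : Tr (D x) :=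
  ⟨Cst.sumElim ⬝ A ⬝ B ⬝ (HoTT.lam fun x => D ⟨x⟩) ⬝ (HoTT.lam fun a => (l ⟨a⟩).e)
    ⬝ (HoTT.lam fun b => (r ⟨b⟩).e) ⬝ x⟩

/-- Case distinction. -/
def cases (x : Tr (Sum A B)) (l : Tr A → Tr C) (r : Tr B → Tr C) : Tr C :=
  sumElim x (fun _ => C) l r

/-! ### Propositional truncation -/

/-- A witness of `∃ (x : A). B x`. -/
def exists' (a : Tr A) (b : Tr (F a)) : Tr (Ex A F) :=
  ⟨Cst.truncIn ⬝ Sigma A F ⬝ (pair a b).e⟩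

/-- Elimination of `∃ (x : A). B x` into a proposition. -/
def exElim (hC : Tr (isProp C)) (x : Tr (Ex A F)) (g : (a : Tr A) → Tr (F a) → Tr C) : Tr C :=
  ⟨Cst.truncElim ⬝ Sigma A F ⬝ (HoTT.lam fun _ => C) ⬝ (HoTT.lam fun _ => hC)
    ⬝ (HoTT.lam fun p => (sigmaElim ⟨p⟩ (fun _ => C) g).e) ⬝ x⟩

def exIsProp : Tr (isProp (Ex A F)) := ⟨Cst.truncIsProp ⬝ Sigma A F⟩

/-- Functoriality of `∃`. -/
def exMap {G : Exp → Exp} (x : Tr (Ex A F)) (g : (a : Tr A) → Tr (F a) → Tr (G a)) :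
    Tr (Ex A G) :=
  exElim exIsProp x fun a b => exists' a (g a b)

/-! ### Brouwer trees -/

def bzero : Tr Cst.brw := ⟨Cst.bzero⟩

def bsucc (x : Tr Cst.brw) : Tr Cst.brw := ⟨Cst.bsucc ⬝ x⟩

def blimit (f : Tr Incr) : Tr Cst.brw := ⟨Cst.blimit ⬝ f⟩

/-- The term of an increasing sequence at an index. -/
def at' (f : Tr Incr) (k : Tr Cst.nat) : Tr Cst.brw := ⟨HoTT.at' f k⟩

def incr (f : Tr Incr) (k : Tr Cst.nat) : Tr (Lt (f.at' k) (f.at' (suc k))) := ⟨HoTT.incr f k⟩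

def bisim {f g : Tr Incr} (r : Tr (Sim f g)) (s : Tr (Sim g f)) :
    Tr (Eq Cst.brw (blimit f) (blimit g)) :=
  ⟨Cst.bisim ⬝ f ⬝ g ⬝ (prodMk r s).e⟩

def brwIsSet : Tr (isSet Cst.brw) := ⟨Cst.brwIsSet⟩

def leZero {x : Exp} : Tr (Le Cst.bzero x) := ⟨Cst.leZero ⬝ x⟩

def leTrans {x y z : Exp} (p : Tr (Le x y)) (q : Tr (Le y z)) : Tr (Le x z) :=
  ⟨Cst.leTrans ⬝ x ⬝ y ⬝ z ⬝ p ⬝ q⟩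

def leSuccMono {x y : Exp} (p : Tr (Le x y)) : Tr (Le (Cst.bsucc ⬝ x) (Cst.bsucc ⬝ y)) :=
  ⟨Cst.leSuccMono ⬝ x ⬝ y ⬝ p⟩

def leCocone {x : Exp} {f : Tr Incr} (k : Tr Cst.nat) (p : Tr (Le x (f.at' k))) :
    Tr (Le x (blimit f)) :=
  ⟨Cst.leCocone ⬝ x ⬝ f ⬝ k ⬝ p⟩

def leLimiting {x : Exp} {f : Tr Incr} (p : Tr (Pi Cst.nat fun k => Le (HoTT.at' f k) x)) :
    Tr (Le (blimit f) x) :=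
  ⟨Cst.leLimiting ⬝ x ⬝ f ⬝ p⟩

def leIsProp {x y : Exp} : Tr (isProp (Le x y)) := ⟨Cst.leIsProp ⬝ x ⬝ y⟩

end Tr

end HoTT

namespace HoTT

open Tr

/-! ## Propositions and sets -/

/-- A reflexive relation with values in propositions that implies equality makes a type a set. -/
def Hedberg : Exp :=
  Pi (U 1) fun X => Pi (X ⇒ X ⇒ U 1) fun R =>
    (Pi X fun x => Pi X fun y => isProp (R ⬝ x ⬝ y)) ⇒ (Pi X fun x => R ⬝ x ⬝ x) ⇒
      (Pi X fun x => Pi X fun y => R ⬝ x ⬝ y ⇒ Eq X x y) ⇒ isSet X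

def PropIsSet : Exp := Pi (U 1) fun A => isProp A ⇒ isSet A

def PropPi : Exp :=
  Pi (U 1) fun A => Pi (A ⇒ U 1) fun B => (Pi A fun x => isProp (B ⬝ x)) ⇒
    isProp (Pi A fun x => B ⬝ x)

def PropIsProp : Exp := Pi (U 1) fun A => isProp (isProp A)

def PropProd : Exp :=
  Pi (U 1) fun A => Pi (U 1) fun B => isProp A ⇒ isProp B ⇒ isProp (Prod A B)

def PropSum : Exp :=
  Pi (U 1) fun A => Pi (U 1) fun B => isProp A ⇒ isProp B ⇒ (A ⇒ B ⇒ Cst.empty) ⇒ isProp (Sum A B)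

def PropExt : Exp :=
  Pi (U 0) fun A => Pi (U 0) fun B => isProp A ⇒ isProp B ⇒ (A ⇒ B) ⇒ (B ⇒ A) ⇒ Eq (U 0) A B

/-- The type of propositions. -/
def HProp : Exp := Sigma (U 0) fun A => isProp A

def HPropExt : Exp :=
  Pi HProp fun X => Pi HProp fun Y =>
    (HoTT.fst (U 0) isProp X ⇒ HoTT.fst (U 0) isProp Y) ⇒
    (HoTT.fst (U 0) isProp Y ⇒ HoTT.fst (U 0) isProp X) ⇒ Eq HProp X Y

namespace Tr

/-- By path induction: at reflexivity both sides compute to the same term. -/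
def reflSymmTrans {A x y : Exp} (p : Tr (Eq A x y)) :
    Tr (Eq (Eq A y y) (refl (A := A) (x := y)) (trans (symm p) p)) :=
  J (fun _ y p => Eq (Eq A y y) (refl (A := A) (x := y)) (trans (symm p) p))
    (fun x => of (Eq (Eq A x x) (refl (A := A) (x := x)) (refl (A := A) (x := x))) refl) p

/-- Every path `p` equals one that is computed from its image in `R x y` alone, after correcting by
the value at `ρ x`. As `R x y` is a proposition, any two paths agree. -/
def hedberg : Tr Hedberg :=
  lam fun X => lam fun R => lam fun hR => lam fun ρ => lam fun f =>
    lam fun x => lam fun y => lam fun p => lam fun q =>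
    let r (x y : Tr X) (p : Tr (Eq X x y)) : Tr (R ⬝ x ⬝ y) :=
      J (fun x y _ => R ⬝ x ⬝ y) (fun x => ρ ⬩ x) p
    let g (x y : Tr X) (s : Tr (R ⬝ x ⬝ y)) : Tr (Eq X x y) :=
      trans (symm (f ⬩ x ⬩ x ⬩ (ρ ⬩ x))) (f ⬩ x ⬩ y ⬩ s)
    let h (p : Tr (Eq X x y)) : Tr (Eq (Eq X x y) p (g x y (r x y p))) :=
      J (fun x y p => Eq (Eq X x y) p (g x y (r x y p)))
        (fun x => (reflSymmTrans (f ⬩ x ⬩ x ⬩ (ρ ⬩ x))).cast) p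
    trans (h p) (trans (cong (g x y) (hR ⬩ x ⬩ y ⬩ r x y p ⬩ r x y q)) (symm (h q)))

/-- Hedberg's argument with the relation that is constantly `unit`. -/
def propIsSet : Tr (Hedberg ⇒ PropIsSet) :=
  let hs (x : Tr Cst.unit) : Tr (Eq Cst.unit star x) :=
    unitElim x (fun x => Eq Cst.unit star x) refl
  lam fun hedberg => lam fun A => lam fun h =>
    (hedberg ⬩ A ⬩ (lam fun _ => lam fun _ => ⟨Cst.unit⟩)
      ⬩ of (Pi A fun _ => Pi A fun _ => isProp Cst.unit)
          (lam fun _ => lam fun _ => lam fun x => lam fun y => trans (symm (hs x)) (hs y))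
      ⬩ of (Pi A fun _ => Cst.unit) (lam fun _ => star)
      ⬩ of (Pi A fun x => Pi A fun y => Cst.unit ⇒ Eq A x y)
          (lam fun x => lam fun y => lam fun _ => h ⬩ x ⬩ y))

def propPi : Tr PropPi :=
  lam fun _ => lam fun _ => lam fun h => lam fun f => lam fun g =>
    funext (lam fun x => h ⬩ x ⬩ (f ⬩ x) ⬩ (g ⬩ x))

def propIsProp : Tr (PropIsSet ⇒ PropIsProp) :=
  lam fun set => lam fun A => lam fun h => lam fun k =>
    funext (lam fun x => funext (lam fun y => set ⬩ A ⬩ h ⬩ x ⬩ y ⬩ (h ⬩ x ⬩ y) ⬩ (k ⬩ x ⬩ y)))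

def propProd : Tr PropProd :=
  lam fun A => lam fun B => lam fun hA => lam fun hB => lam fun p => lam fun q =>
    sigmaElim p (fun p => Eq (Prod A B) p q) fun a b =>
      sigmaElim q (fun q => Eq (Prod A B) (prodMk a b) q) fun a' b' =>
        trans (cong (fun a => prodMk a b) (hA ⬩ a ⬩ a')) (cong (fun b => prodMk a' b) (hB ⬩ b ⬩ b'))

def propSum : Tr PropSum :=
  lam fun A => lam fun B => lam fun hA => lam fun hB => lam fun h => lam fun p => lam fun q =>
    sumElim p (fun p => Eq (Sum A B) p q)
      (fun a => sumElim q (fun q => Eq (Sum A B) (inl (B := B) a) q)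
        (fun a' => cong (fun a => inl a) (hA ⬩ a ⬩ a')) (fun b => absurd (h ⬩ a ⬩ b)))
      (fun b => sumElim q (fun q => Eq (Sum A B) (inr (A := A) b) q)
        (fun a => absurd (h ⬩ a ⬩ b)) (fun b' => cong (fun b => inr b) (hB ⬩ b ⬩ b')))

/-- The inverse of `idToEquiv`. -/
def ua {A B : Exp} (e : Tr (Equiv A B)) : Tr (Eq (U 0) A B) :=
  let u : Tr (isEquiv (Eq (U 0) A B) (Equiv A B) (idToEquiv 0 A B)) := ⟨Cst.univalence ⬝ A ⬝ B⟩
  fst (fst u) ⬩ e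

def propExt : Tr PropExt :=
  lam fun _ => lam fun _ => lam fun hA => lam fun hB => lam fun f => lam fun g =>
    ua (pair f
      (prodMk
        (pair g (lam fun y => hB ⬩ (f ⬩ (g ⬩ y)) ⬩ y))
        (pair g (lam fun x => hA ⬩ (g ⬩ (f ⬩ x)) ⬩ x))))

def hPropExt : Tr (PropIsProp ⇒ PropExt ⇒ HPropExt) :=
  lam fun prop => lam fun ext => lam fun X => lam fun Y =>
    let T (X : Exp) := HoTT.fst (U 0) isProp X
    sigmaElim X (fun X => (T X ⇒ T Y) ⇒ (T Y ⇒ T X) ⇒ Eq HProp X Y) fun A hA =>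
      of ((A ⇒ T Y) ⇒ (T Y ⇒ A) ⇒ Eq HProp (pair (F := isProp) A hA) Y) <|
        sigmaElim Y (fun Y => (A ⇒ T Y) ⇒ (T Y ⇒ A) ⇒ Eq HProp (pair (F := isProp) A hA) Y)
          fun B hB =>
        of ((A ⇒ B) ⇒ (B ⇒ A) ⇒ Eq HProp (pair (F := isProp) A hA) (pair (F := isProp) B hB)) <|
          lam fun f => lam fun g =>
            -- The proofs that `A` and `B` are propositions are generalised first; once `A` and `B`
            -- are identified, they agree because being a proposition is one.
            J (fun A B _ => Pi (isProp A) fun hA => Pi (isProp B) fun hB =>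
                Eq HProp (mkPair (U 0) isProp A hA) (mkPair (U 0) isProp B hB))
              (fun A => lam fun h => lam fun k =>
                cong (fun h => pair (F := isProp) A h) (prop ⬩ A.cast ⬩ h ⬩ k))
              (ext ⬩ A ⬩ B ⬩ hA ⬩ hB ⬩ f ⬩ g) ⬩ hA ⬩ hB

end Tr

end HoTT

namespace HoTT

/-! ## Induction on Brouwer trees and characterisation of the strict order -/

/-- Induction on Brouwer trees with a family of propositions as motive. -/
def BrwInd : Exp :=
  Pi (Cst.brw ⇒ U 1) fun P => (Pi Cst.brw fun x => isProp (P ⬝ x)) ⇒ P ⬝ Cst.bzero ⇒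
    (Pi Cst.brw fun x => P ⬝ x ⇒ P ⬝ (Cst.bsucc ⬝ x)) ⇒
    (Pi Incr fun f => (Pi Cst.nat fun k => P ⬝ at' f k) ⇒ P ⬝ (Cst.blimit ⬝ f)) ⇒
    Pi Cst.brw fun x => P ⬝ x

def LeRefl : Exp := Pi Cst.brw fun x => Le x x

/-- Quantification over the families that satisfy the rules which characterise `<`. -/
def CodeElim (B : Exp) : Exp :=
  Pi (Cst.brw ⇒ Cst.brw ⇒ U 0) fun C =>
    (Pi Cst.brw fun x => C ⬝ x ⬝ Cst.bzero ⇒ Cst.empty) ⇒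
    (Pi Cst.brw fun x => Pi Cst.brw fun y => C ⬝ x ⬝ (Cst.bsucc ⬝ y) ⇒ Le x y) ⇒
    (Pi Cst.brw fun x => Pi Cst.brw fun y => Le x y ⇒ C ⬝ x ⬝ (Cst.bsucc ⬝ y)) ⇒
    (Pi Cst.brw fun x => Pi Incr fun f =>
      C ⬝ x ⬝ (Cst.blimit ⬝ f) ⇒ Ex Cst.nat fun k => C ⬝ x ⬝ at' f k) ⇒
    (Pi Cst.brw fun x => Pi Cst.brw fun y => Pi Cst.brw fun z =>
      Le y z ⇒ C ⬝ x ⬝ y ⇒ C ⬝ x ⬝ z) ⇒ B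

def LtZero : Exp := Pi Cst.brw fun x => Lt x Cst.bzero ⇒ Cst.empty

def LtSucc : Exp := Pi Cst.brw fun x => Pi Cst.brw fun y => Lt x (Cst.bsucc ⬝ y) ⇒ Le x y

def LtLimit : Exp :=
  Pi Cst.brw fun x => Pi Incr fun f => Lt x (Cst.blimit ⬝ f) ⇒ Ex Cst.nat fun k => Lt x (at' f k)

/-- The characterisation of `x < y` by the form of `y`. -/
def LtInv : Exp := Prod LtZero (Prod LtSucc LtLimit)

namespace Tr

/-- The eliminator for Brouwer trees, applied to the methods of `m`. -/
def brwElim (m : Alg) (x : Tr Cst.brw) : Tr (m.P ⬝ x) := ⟨m.rec' x⟩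

def leElim (m : Alg) {x y : Exp} (l : Tr (Le x y)) : Tr (m.Q ⬝ x ⬝ y ⬝ l ⬝ m.rec' x ⬝ m.rec' y) :=
  ⟨m.recLe x y l⟩

/-- The methods of an induction into a family `P` of propositions. -/
def propAlg (set : Tr PropIsSet) {P : Exp} (hP : Tr (Pi Cst.brw fun x => isProp (P ⬝ x)))
    (z : Tr (P ⬝ Cst.bzero)) (s : Tr (Pi Cst.brw fun x => P ⬝ x ⇒ P ⬝ (Cst.bsucc ⬝ x)))
    (l : Tr (Pi Incr fun f => (Pi Cst.nat fun k => P ⬝ HoTT.at' f k) ⇒ P ⬝ (Cst.blimit ⬝ f))) :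
    Alg where
  P := HoTT.lam fun x => P ⬝ x
  Q := HoTT.lam fun _ => HoTT.lam fun _ => HoTT.lam fun _ => HoTT.lam fun _ => HoTT.lam fun _ =>
    Cst.unit
  pZero := z
  pSucc := s
  pLimit := HoTT.lam fun f => HoTT.lam fun u => HoTT.lam fun _ => l.e ⬝ f ⬝ u
  pBisim := HoTT.lam fun f => HoTT.lam fun u => HoTT.lam fun _ =>
    HoTT.lam fun g => HoTT.lam fun v => HoTT.lam fun _ => HoTT.lam fun r =>
    HoTT.lam fun _ => HoTT.lam fun _ => hP.e ⬝ (Cst.blimit ⬝ g)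
      ⬝ transport Cst.brw (HoTT.lam fun x => P ⬝ x) (Cst.blimit ⬝ f) (Cst.blimit ⬝ g)
        (Cst.bisim ⬝ f ⬝ g ⬝ r) (l.e ⬝ f ⬝ u)
      ⬝ (l.e ⬝ g ⬝ v)
  pSet := HoTT.lam fun x => set.e ⬝ (P ⬝ x) ⬝ (hP.e ⬝ x)
  qZero := HoTT.lam fun _ => HoTT.lam fun _ => Cst.star
  qTrans := HoTT.lam fun _ => HoTT.lam fun _ => HoTT.lam fun _ => HoTT.lam fun _ => HoTT.lam fun _ =>
    HoTT.lam fun _ => HoTT.lam fun _ => HoTT.lam fun _ => HoTT.lam fun _ => HoTT.lam fun _ => Cst.star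
  qSucc := HoTT.lam fun _ => HoTT.lam fun _ => HoTT.lam fun _ => HoTT.lam fun _ => HoTT.lam fun _ =>
    HoTT.lam fun _ => Cst.star
  qCocone := HoTT.lam fun _ => HoTT.lam fun _ => HoTT.lam fun _ => HoTT.lam fun _ =>
    HoTT.lam fun _ => HoTT.lam fun _ => HoTT.lam fun _ => HoTT.lam fun _ => Cst.star
  qLimiting := HoTT.lam fun _ => HoTT.lam fun _ => HoTT.lam fun _ => HoTT.lam fun _ =>
    HoTT.lam fun _ => HoTT.lam fun _ => HoTT.lam fun _ => Cst.star
  qProp := HoTT.lam fun _ => HoTT.lam fun _ => HoTT.lam fun _ => HoTT.lam fun _ => HoTT.lam fun _ =>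
    (lam (A := Cst.unit) (F := fun x => Pi Cst.unit fun y => Eq Cst.unit x y) fun x => lam fun y =>
      unitElim x (fun x => Eq Cst.unit x y) (unitElim y (fun y => Eq Cst.unit star y) refl)).e

/-- The motive over `≤` is `unit`, and the path and set constructors cost nothing because the motive
over trees is a family of propositions. -/
def brwInd : Tr (PropIsSet ⇒ BrwInd) :=
  lam fun set => lam fun P => lam fun hP => lam fun z => lam fun s => lam fun l => lam fun x =>
    of (P ⬝ x) (cast (brwElim (propAlg set hP z s l) x))

/-- Induction for a family of propositions. -/
def induct (ind : Tr BrwInd) (D : Tr Cst.brw → Exp) (hD : (x : Tr Cst.brw) → Tr (isProp (D x)))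
    (z : Tr (D bzero)) (s : (x : Tr Cst.brw) → Tr (D x) → Tr (D (bsucc x)))
    (l : (f : Tr Incr) → Tr (Pi Cst.nat fun k => D ⟨HoTT.at' f k⟩) → Tr (D (blimit f)))
    (x : Tr Cst.brw) : Tr (D x) :=
  of (D x) (cast (ind ⬩ lam (fun x => ⟨D x⟩) ⬩ of (Pi Cst.brw fun x => isProp (D ⟨x⟩)) (lam hD)
    ⬩ of (D bzero) z ⬩ of (Pi Cst.brw fun x => D ⟨x⟩ ⇒ D (bsucc ⟨x⟩)) (lam fun x => lam fun h => s x h)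
    ⬩ of (Pi Incr fun f => (Pi Cst.nat fun k => D ⟨HoTT.at' f k⟩) ⇒ D (blimit ⟨f⟩))
      (lam fun f => lam fun h => l f h) ⬩ x))

def piIsProp (pi : Tr PropPi) {A : Exp} {F : Exp → Exp} (h : (x : Tr A) → Tr (isProp (F x))) :
    Tr (isProp (Pi A F)) :=
  of (isProp (Pi A F)) (cast (pi ⬩ ⟨A⟩ ⬩ lam (fun x => ⟨F x⟩) ⬩ of (Pi A fun x => isProp (F x)) (lam h)))

def leRefl : Tr (BrwInd ⇒ LeRefl) :=
  lam fun ind => lam fun x => induct ind (fun x => Le x x) (fun _ => leIsProp) leZero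
    (fun _ h => leSuccMono h) (fun _ h => leLimiting (lam fun k => leCocone k (h ⬩ k))) x

/-- The underlying type of a proposition. -/
def El (X : Exp) : Exp := HoTT.fst (U 0) isProp X

def mkProp (A : Exp) (h : Tr (isProp A)) : Tr HProp := pair (F := isProp) ⟨A⟩ h

def elIsProp (X : Tr HProp) : Tr (isProp (El X)) := snd X

/-- Hedberg's argument with logical equivalence as the relation; needed because the recursion on
trees requires a set as target. -/
def hPropIsSet : Tr (Hedberg ⇒ PropPi ⇒ PropProd ⇒ HPropExt ⇒ isSet HProp) :=
  lam fun hedberg => lam fun pi => lam fun prod => lam fun ext =>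
    let R (X Y : Exp) := Prod (El X ⇒ El Y) (El Y ⇒ El X)
    let arrow (X Y : Tr HProp) : Tr (isProp (El X ⇒ El Y)) := piIsProp pi fun _ => elIsProp Y
    hedberg ⬩ ⟨HProp⟩ ⬩ lam (fun X => lam fun Y => ⟨R X Y⟩)
      ⬩ of (Pi HProp fun X => Pi HProp fun Y => isProp (R X Y))
        (lam fun X => lam fun Y => prod ⬩ ⟨El X ⇒ El Y⟩ ⬩ ⟨El Y ⇒ El X⟩ ⬩ arrow X Y ⬩ arrow Y X)
      ⬩ of (Pi HProp fun X => R X X) (lam fun _ => prodMk (lam fun a => a) (lam fun a => a))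
      ⬩ of (Pi HProp fun X => Pi HProp fun Y => R X Y ⇒ Eq HProp X Y)
        (lam fun X => lam fun Y => lam fun r => ext ⬩ X ⬩ Y ⬩ fst r ⬩ snd r)

/-- Transport in a constant family. -/
def transportConst {A B x y : Exp} (p : Tr (Eq A x y)) (b : Tr B) :
    Tr (Eq B (transport A (HoTT.lam fun _ => B) x y p b) b) :=
  J (fun x y p => Eq B (transport A (HoTT.lam fun _ => B) x y p b) b) (fun _ => of (Eq B b b) refl) p

/-- The proposition that some member of a sequence of propositions holds. -/
def someProp (u : Exp) : Tr HProp := mkProp (Ex Cst.nat fun k => El (u ⬝ k)) exIsProp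

/-- The methods that define `x < y` as a proposition by recursion on `y`. -/
def codeAlg (pi : Tr PropPi) (set : Tr (isSet HProp)) (ext : Tr HPropExt) (x : Exp) : Alg where
  P := HoTT.lam fun _ => HProp
  Q := HoTT.lam fun _ => HoTT.lam fun _ => HoTT.lam fun _ => HoTT.lam fun u => HoTT.lam fun v =>
    -- Monotonicity in the second argument is defined simultaneously with the code; it is what makes
    -- the codes at bisimilar limits agree.
    El u ⇒ El v
  pZero := (mkProp Cst.empty (lam fun a => absurd a)).e
  pSucc := HoTT.lam fun y => HoTT.lam fun _ => (mkProp (Le x y) leIsProp).e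
  pLimit := HoTT.lam fun _ => HoTT.lam fun u => HoTT.lam fun _ => (someProp u).e
  pBisim :=
    let sim (f g u v : Exp) (s : Tr (Pi Cst.nat fun k => Ex Cst.nat fun n =>
        Sigma (Le (HoTT.at' f k) (HoTT.at' g n)) fun _ => El (u ⬝ k) ⇒ El (v ⬝ n))) :
        Tr (El (someProp u) ⇒ El (someProp v)) :=
      of ((Ex Cst.nat fun k => El (u ⬝ k)) ⇒ (Ex Cst.nat fun k => El (v ⬝ k)))
        (lam fun e => exElim exIsProp e fun k a =>
          exElim exIsProp (s ⬩ k) fun n p => exists' n (snd p ⬩ a))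
    HoTT.lam fun f => HoTT.lam fun u => HoTT.lam fun _ => HoTT.lam fun g => HoTT.lam fun v =>
      HoTT.lam fun _ => HoTT.lam fun r => HoTT.lam fun s => HoTT.lam fun t =>
      (trans (transportConst (A := Cst.brw) (x := Cst.blimit ⬝ f) (y := Cst.blimit ⬝ g)
          ⟨Cst.bisim ⬝ f ⬝ g ⬝ r⟩ (someProp u))
        (ext ⬩ someProp u ⬩ someProp v ⬩ sim f g u v ⟨s⟩ ⬩ sim g f v u ⟨t⟩)).e
  pSet := HoTT.lam fun _ => set.e
  qZero := HoTT.lam fun _ => HoTT.lam fun u =>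
    (of (Cst.empty ⇒ El u) (lam fun a => absurd a) : Tr (Cst.empty ⇒ El u)).e
  qTrans := HoTT.lam fun _ => HoTT.lam fun _ => HoTT.lam fun _ => HoTT.lam fun _ => HoTT.lam fun _ =>
    HoTT.lam fun _ => HoTT.lam fun _ => HoTT.lam fun _ => HoTT.lam fun p => HoTT.lam fun q =>
    HoTT.lam fun a => q ⬝ (p ⬝ a)
  qSucc := HoTT.lam fun y => HoTT.lam fun z => HoTT.lam fun _ => HoTT.lam fun _ => HoTT.lam fun l =>
    HoTT.lam fun _ => HoTT.lam fun a => Cst.leTrans ⬝ x ⬝ y ⬝ z ⬝ a ⬝ l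
  qCocone := HoTT.lam fun _ => HoTT.lam fun _ => HoTT.lam fun _ => HoTT.lam fun v =>
    HoTT.lam fun _ => HoTT.lam fun k => HoTT.lam fun _ => HoTT.lam fun q => HoTT.lam fun a =>
    (exists' (A := Cst.nat) (F := fun k => El (v ⬝ k)) ⟨k⟩ ⟨q ⬝ a⟩).e
  qLimiting := HoTT.lam fun _ => HoTT.lam fun u => HoTT.lam fun _ => HoTT.lam fun v =>
    HoTT.lam fun _ => HoTT.lam fun _ => HoTT.lam fun q => HoTT.lam fun a =>
    (exElim (A := Cst.nat) (F := fun k => El (v ⬝ k)) (elIsProp ⟨u⟩) ⟨a⟩ fun k b => ⟨q ⬝ k ⬝ b⟩).e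
  qProp := HoTT.lam fun _ => HoTT.lam fun _ => HoTT.lam fun _ => HoTT.lam fun u => HoTT.lam fun v =>
    (piIsProp pi (A := El u) (F := fun _ => El v) fun _ => elIsProp ⟨v⟩).e

/-- Encoding: `C x (succ x)` holds by reflexivity of `≤`, and monotonicity carries it along `succ x
≤ y`. Decoding is by induction on `y`. The defining rules of `C` thereby become inversion rules for
`<`. Keeping `C` a variable hides the recursion that defines it. -/
def ltInv : Tr (PropPi ⇒ BrwInd ⇒ LeRefl ⇒ CodeElim LtInv) :=
  lam fun pi => lam fun ind => lam fun refl => lam fun C => lam fun czero => lam fun csucc =>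
    lam fun succc => lam fun climit => lam fun cle =>
      have' (B := LtInv) (A := Pi Cst.brw fun x => Pi Cst.brw fun y => Lt x y ⇒ C.e ⬝ x ⬝ y)
        (lam fun x => lam fun y => lam fun l =>
          cle ⬩ x ⬩ bsucc x ⬩ y ⬩ l ⬩ (succc ⬩ x ⬩ x ⬩ (refl ⬩ x)))
      fun enc =>
      have' (B := LtInv) (A := Pi Cst.brw fun x => Pi Cst.brw fun y => C.e ⬝ x ⬝ y ⇒ Lt x y)
        (lam fun x => lam fun y =>
          induct ind (fun y => C.e ⬝ x ⬝ y ⇒ Lt x y) (fun _ => piIsProp pi fun _ => leIsProp)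
            (lam fun c => absurd (czero ⬩ x ⬩ c))
            (fun y _ => lam fun c => leSuccMono (csucc ⬩ x ⬩ y ⬩ c))
            (fun f h => lam fun c => exElim leIsProp (climit ⬩ x ⬩ f ⬩ c) fun k c =>
              leCocone k (h ⬩ k ⬩ c)) y)
      fun dec =>
      prodMk (lam fun x => lam fun l => czero ⬩ x ⬩ (enc ⬩ x ⬩ bzero ⬩ l)) <|
      prodMk (lam fun x => lam fun y => lam fun l => csucc ⬩ x ⬩ y ⬩ (enc ⬩ x ⬩ bsucc y ⬩ l)) <|
      lam fun x => lam fun f => lam fun l =>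
        exMap (climit ⬩ x ⬩ f ⬩ (enc ⬩ x ⬩ blimit f ⬩ l)) fun k c => dec ⬩ x ⬩ at' f k ⬩ c

/-- The first four rules hold by computation, so identity functions prove them; monotonicity is the
part of the recursion over `≤`. -/
def codeElim : Tr (PropPi ⇒ isSet HProp ⇒ HPropExt ⇒ CodeElim LtInv ⇒ LtInv) :=
  lam fun pi => lam fun set => lam fun ext => lam fun h =>
    let m (x : Exp) : Alg := codeAlg pi set ext x
    let code (x y : Exp) : Exp := El ((m x).rec' y)
    cast <| h ⬩ lam (fun x => lam fun y => ⟨code x y⟩)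
      ⬩ of (Pi Cst.brw fun _ => Cst.empty ⇒ Cst.empty) (lam fun _ => lam fun c => c)
      ⬩ of (Pi Cst.brw fun x => Pi Cst.brw fun y => Le x y ⇒ Le x y)
        (lam fun _ => lam fun _ => lam fun c => c)
      ⬩ of (Pi Cst.brw fun x => Pi Cst.brw fun y => Le x y ⇒ Le x y)
        (lam fun _ => lam fun _ => lam fun c => c)
      ⬩ of (Pi Cst.brw fun x => Pi Incr fun f => Ex Cst.nat (fun k => code x (HoTT.at' f k)) ⇒
          Ex Cst.nat (fun k => code x (HoTT.at' f k)))
        (lam fun _ => lam fun _ => lam fun c => c)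
      ⬩ of (Pi Cst.brw fun x => Pi Cst.brw fun y => Pi Cst.brw fun z => Le y z ⇒
          code x y ⇒ code x z)
        (lam fun x => lam fun _ => lam fun _ => lam fun l => cast (leElim (m x) l))

end Tr
end HoTT

namespace HoTT

/-! ## Properties of the order -/

def LeSucc : Exp := Pi Cst.brw fun x => Le x (Cst.bsucc ⬝ x)

def LtIrrefl : Exp := Pi Cst.brw fun x => Lt x x ⇒ Cst.empty

def LeAntisymm : Exp :=
  Pi Cst.brw fun x => Pi Cst.brw fun y => Le x y ⇒ Le y x ⇒ Eq Cst.brw x y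

namespace Tr

def ltZero : Tr (LtInv ⇒ LtZero) := lam fun h => fst h

def ltSucc : Tr (LtInv ⇒ LtSucc) := lam fun h => fst (snd h)

def ltLimit : Tr (LtInv ⇒ LtLimit) := lam fun h => snd (snd h)

def emptyIsProp : Tr (isProp Cst.empty) := lam fun x => absurd x

def leSucc : Tr (BrwInd ⇒ LeSucc) :=
  lam fun ind => lam fun x => induct ind (fun x => Le x (bsucc x)) (fun _ => leIsProp) leZero
    (fun _ h => leSuccMono h)
    (fun f h => leLimiting (lam fun k =>
      leTrans (h ⬩ k) (leSuccMono (leTrans (h ⬩ k) (leCocone (f := f) (suc k) (f.incr k)))))) x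

/-- Every term of a sequence is below its limit. -/
def atLtLimit (refl : Tr LeRefl) (f : Tr Incr) (k : Tr Cst.nat) : Tr (Lt (f.at' k) (blimit f)) :=
  leTrans (f.incr k) (leCocone (suc k) (refl ⬩ f.at' (suc k)))

/-- At a limit, `limit f < limit f` gives `limit f < f k` for some `k`; since `f k ≤ limit f`, this
yields `f k < f k`. -/
def ltIrrefl : Tr (PropPi ⇒ BrwInd ⇒ LeRefl ⇒ LtZero ⇒ LtSucc ⇒ LtLimit ⇒ LtIrrefl) :=
  lam fun pi => lam fun ind => lam fun refl => lam fun ltZero => lam fun ltSucc => lam fun ltLimit =>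
    lam fun x => induct ind (fun x => Lt x x ⇒ Cst.empty) (fun _ => piIsProp pi fun _ => emptyIsProp)
      (ltZero ⬩ bzero) (fun x h => lam fun l => h ⬩ (ltSucc ⬩ bsucc x ⬩ x ⬩ l))
      (fun f h => lam fun l => exElim emptyIsProp (ltLimit ⬩ blimit f ⬩ f ⬩ l) fun k p =>
        h ⬩ k ⬩ leTrans (leSuccMono (leCocone k (refl ⬩ f.at' k))) p) x

/-- Double induction: trees of different shapes cannot bound each other, successors reduce to the
hypothesis, and mutually bounded limits are bisimilar. -/
def leAntisymm : Tr (PropPi ⇒ BrwInd ⇒ LeRefl ⇒ LeSucc ⇒ LtZero ⇒ LtSucc ⇒ LtLimit ⇒ LtIrrefl ⇒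
    LeAntisymm) :=
  lam fun pi => lam fun ind => lam fun refl => lam fun leSucc => lam fun ltZero => lam fun ltSucc =>
    lam fun ltLimit => lam fun irrefl =>
    let hp (x y : Tr Cst.brw) : Tr (isProp (Le x y ⇒ Le y x ⇒ Eq Cst.brw x y)) :=
      piIsProp pi fun _ => piIsProp pi fun _ => brwIsSet ⬩ x ⬩ y
    let limitZero (f : Tr Incr) (p : Tr (Le (blimit f) Cst.bzero)) : Tr Cst.empty :=
      ltZero ⬩ f.at' zero ⬩ leTrans (atLtLimit refl f zero) p
    -- No limit lies between `x` and its successor: from `x < f k` and `f k < limit f ≤ succ x`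
    -- follow `f k ≤ x` and so `x < x`.
    let limitSucc (x : Tr Cst.brw) (f : Tr Incr) (p : Tr (Lt x (blimit f)))
        (q : Tr (Le (blimit f) (bsucc x))) : Tr Cst.empty :=
      exElim emptyIsProp (ltLimit ⬩ x ⬩ f ⬩ p) fun k a =>
        irrefl ⬩ x ⬩ leTrans a (ltSucc ⬩ f.at' k ⬩ x ⬩ leTrans (atLtLimit refl f k) q)
    let sim (f g : Tr Incr) (p : Tr (Le (blimit f) (blimit g))) : Tr (Sim f g) :=
      lam fun k => exMap (ltLimit ⬩ f.at' k ⬩ g ⬩ leTrans (atLtLimit refl f k) p) fun _ a =>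
        leTrans (leSucc ⬩ f.at' k) a
    lam fun x => induct ind (fun x => Pi Cst.brw fun y => Le x y ⇒ Le y x ⇒ Eq Cst.brw x y)
      (fun x => piIsProp pi fun y => hp x y)
      (lam fun y => induct ind (fun y => Le bzero y ⇒ Le y bzero ⇒ Eq Cst.brw bzero y) (hp bzero)
        (lam fun _ => lam fun _ => .refl)
        (fun y _ => lam fun _ => lam fun q => absurd (ltZero ⬩ y ⬩ q))
        (fun g _ => lam fun _ => lam fun q => absurd (limitZero g q)) y)
      (fun x h => lam fun y => induct ind (fun y => Le (bsucc x) y ⇒ Le y (bsucc x) ⇒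
          Eq Cst.brw (bsucc x) y) (hp (bsucc x))
        (lam fun p => lam fun _ => absurd (ltZero ⬩ x ⬩ p))
        (fun y _ => lam fun p => lam fun q =>
          cong bsucc (h ⬩ y ⬩ (ltSucc ⬩ x ⬩ y ⬩ p) ⬩ (ltSucc ⬩ y ⬩ x ⬩ q)))
        (fun g _ => lam fun p => lam fun q => absurd (limitSucc x g p q)) y)
      (fun f _ => lam fun y => induct ind (fun y => Le (blimit f) y ⇒ Le y (blimit f) ⇒
          Eq Cst.brw (blimit f) y) (hp (blimit f))
        (lam fun p => lam fun _ => absurd (limitZero f p))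
        (fun y _ => lam fun p => lam fun q => absurd (limitSucc y f q p))
        (fun g _ => lam fun p => lam fun q => bisim (sim f g p) (sim g f q)) y) x

end Tr

/-! ## Consequences of the limited principle of omniscience -/

/-- The limited principle of omniscience for families of which one of two alternatives holds. -/
def AltLPO : Exp :=
  Pi (Cst.nat ⇒ U 1) fun P => Pi (Cst.nat ⇒ U 1) fun Q => (Pi Cst.nat fun n => Sum (P ⬝ n) (Q ⬝ n)) ⇒
    Sum (Pi Cst.nat fun n => P ⬝ n) (Ex Cst.nat fun n => Q ⬝ n)

def Dichotomy : Exp := Pi Cst.brw fun x => Pi Cst.brw fun y => Sum (Lt x y) (Le y x)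

namespace Tr

def ffNeTt (p : Tr (Eq Cst.bool ff tt)) : Tr Cst.empty :=
  let D (b : Tr Cst.bool) : Tr (U 0) := boolElim b (fun _ => U 0) ⟨Cst.unit⟩ ⟨Cst.empty⟩
  of (D tt) (subst (fun b => D b) p (of Cst.unit star))

/-- LPO is applied to the bits recording which alternative was chosen. Case analysis on the
decision, with its bit generalised too, recovers the proof of that alternative. -/
def altLPO : Tr (LPO ⇒ AltLPO) :=
  lam fun lpo => lam fun P => lam fun Q => lam fun d =>
    let bit {A B : Exp} (x : Tr (Sum A B)) : Tr Cst.bool := cases x (fun _ => ff) (fun _ => tt)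
    let s : Tr (Cst.nat ⇒ Cst.bool) := lam fun n => bit (d ⬩ n)
    let left (n : Tr Cst.nat) : Tr (Eq Cst.bool (bit (d ⬩ n)) ff ⇒ P ⬝ n) :=
      sumElim (d ⬩ n) (fun x => Eq Cst.bool (bit x) ff ⇒ P ⬝ n) (fun p => lam fun _ => p)
        (fun _ => lam fun e => absurd (ffNeTt (symm e.cast)))
    let right (n : Tr Cst.nat) : Tr (Eq Cst.bool (bit (d ⬩ n)) tt ⇒ Q ⬝ n) :=
      sumElim (d ⬩ n) (fun x => Eq Cst.bool (bit x) tt ⇒ Q ⬝ n)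
        (fun _ => lam fun e => absurd (ffNeTt e.cast)) (fun q => lam fun _ => q)
    cases (lpo ⬩ s) (fun h => inl (lam fun n => left n ⬩ (h ⬩ n).cast))
      (fun h => inr (exMap h fun n e => right n ⬩ e.cast))

/-- The two alternatives exclude each other by irreflexivity, so their sum is a proposition and
truncated existentials may be eliminated into it. -/
def dichotomy : Tr (PropPi ⇒ PropSum ⇒ BrwInd ⇒ LeRefl ⇒ LtSucc ⇒ LtIrrefl ⇒ AltLPO ⇒ Dichotomy) :=
  lam fun pi => lam fun sum => lam fun ind => lam fun refl => lam fun ltSucc => lam fun irrefl =>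
    lam fun lpo =>
    let D (x y : Exp) : Exp := Sum (Lt x y) (Le y x)
    let hD (x y : Tr Cst.brw) : Tr (isProp (D x y)) :=
      sum ⬩ ⟨Lt x y⟩ ⬩ ⟨Le y x⟩ ⬩ leIsProp ⬩ leIsProp ⬩
        lam fun p => lam fun q => irrefl ⬩ x ⬩ leTrans p q
    -- Either all `g k ≤ x`, so the limit is below `x`, or some `g k` is strictly above `x`.
    let limitRight (x : Tr Cst.brw) (g : Tr Incr) (h : Tr (Pi Cst.nat fun k => D x (HoTT.at' g k))) :
        Tr (D x (blimit g)) :=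
      cases (lpo ⬩ lam (fun k => ⟨Le (g.at' k) x⟩) ⬩ lam (fun k => ⟨Lt x (g.at' k)⟩)
          ⬩ of (Pi Cst.nat fun k => Sum (Le (HoTT.at' g k) x) (Lt x (HoTT.at' g k)))
            (lam fun k => cases (h ⬩ k) inr inl))
        (fun a => inr (leLimiting (cast a)))
        (fun a => exElim (hD x (blimit g)) a fun k p => inl (leCocone k p.cast))
    lam fun x => induct ind (fun x => Pi Cst.brw fun y => D x y)
      (fun x => piIsProp pi fun y => hD x y)
      (lam fun y => induct ind (fun y => D bzero y) (hD bzero) (inr leZero)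
        (fun _ _ => inl (leSuccMono leZero))
        (fun g _ => inl (leTrans (leSuccMono leZero) (atLtLimit refl g zero))) y)
      (fun x h => lam fun y => induct ind (fun y => D (bsucc x) y) (hD (bsucc x)) (inr leZero)
        (fun y _ => cases (h ⬩ y) (fun p => inl (leSuccMono p)) (fun p => inr (leSuccMono p)))
        (fun g k => limitRight (bsucc x) g k) y)
      (fun f h => lam fun y => induct ind (fun y => D (blimit f) y) (hD (blimit f)) (inr leZero)
        (fun y _ =>
          -- If every `f k < succ y`, then every `f k ≤ y`, so `limit f ≤ y` and the strict
          -- inequality follows; otherwise `succ y ≤ f k` for some `k`.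
          cases (lpo ⬩ lam (fun k => ⟨Lt (f.at' k) (bsucc y)⟩) ⬩ lam (fun k => ⟨Le (bsucc y) (f.at' k)⟩)
              ⬩ of (Pi Cst.nat fun k => D (HoTT.at' f k) (bsucc y)) (lam fun k => h ⬩ k ⬩ bsucc y))
            (fun a => inl (leSuccMono (leLimiting (lam fun k =>
              ltSucc ⬩ f.at' k ⬩ y ⬩ (a ⬩ k).cast))))
            (fun a => exElim (hD (blimit f) (bsucc y)) a fun k p => inr (leCocone k p.cast)))
        (fun g k => limitRight (blimit f) g k) y) x

def trichotomy : Tr (LeAntisymm ⇒ Dichotomy ⇒ Trichotomy) :=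
  lam fun antisymm => lam fun d => lam fun x => lam fun y =>
    cases (d ⬩ x ⬩ y) inl fun p =>
      cases (d ⬩ y ⬩ x) (fun q => inr (inr q)) fun q => inr (inl (antisymm ⬩ x ⬩ y ⬩ q ⬩ p))

def splitting : Tr (LtIrrefl ⇒ Trichotomy ⇒ Splitting) :=
  lam fun irrefl => lam fun tri => lam fun x => lam fun y => lam fun l =>
    cases (tri ⬩ x ⬩ y) inl fun p =>
      cases p inr fun q => absurd (irrefl ⬩ y ⬩ leTrans q l)

end Tr

end HoTT

namespace HoTT

/-! ## Consequences of the splitting of `≤` -/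

/-- `v` is a limit of `f`. -/
def IsLimit (f v : Exp) : Exp :=
  Prod (Pi Cst.nat fun k => Le (f ⬝ k) v)
    (Prod (Pi Cst.brw fun x => (Pi Cst.nat fun k => Le (f ⬝ k) x) ⇒ Le v x)
      (Pi Cst.brw fun x => Lt x v ⇒ Ex Cst.nat fun k => Lt x (f ⬝ k)))

/-- Every strictly increasing sequence has a limit. -/
def SeqLim : Exp :=
  Pi (Cst.nat ⇒ Cst.brw) fun f => isIncr f ⇒ Sigma Cst.brw fun v => IsLimit f v

namespace Tr

/-- Limits are repackaged by their order properties, so that the construction below works with plain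
functions and opaque limits. -/
def seqLim : Tr (LeRefl ⇒ LtLimit ⇒ SeqLim) :=
  lam fun refl => lam fun ltLimit => lam fun f => lam fun h =>
    let g : Tr Incr := pair f h
    let le : Tr (Pi Cst.nat fun k => Le (f ⬝ k) (blimit g)) :=
      lam fun k => leCocone (f := g) k (cast (refl ⬩ (f ⬩ k)))
    let least : Tr (Pi Cst.brw fun x => (Pi Cst.nat fun k => Le (f ⬝ k) x) ⇒ Le (blimit g) x) :=
      lam fun _ => lam fun p => leLimiting (f := g) (cast p)
    let reach : Tr (Pi Cst.brw fun x => Lt x (blimit g) ⇒ Ex Cst.nat fun k => Lt x (f ⬝ k)) :=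
      lam fun x => lam fun p => (ltLimit ⬩ x ⬩ g ⬩ p).cast
    pair (F := IsLimit f) (blimit g) (prodMk le (prodMk least reach))

/-- The tree that represents a natural number. -/
def num (k : Tr Cst.nat) : Tr Cst.brw :=
  natElim k (fun _ => Cst.brw) bzero fun _ x => bsucc x

/-- The `k`-th successor of `w`. -/
def above (w : Tr Cst.brw) (k : Tr Cst.nat) : Tr Cst.brw :=
  natElim k (fun _ => Cst.brw) w fun _ x => bsucc x

/-- The tree `k` or `w + k`, depending on a bit. -/
def jump (w : Tr Cst.brw) (b : Tr Cst.bool) (k : Tr Cst.nat) : Tr Cst.brw :=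
  boolElim b (fun _ => Cst.brw) (num k) (above w k)

def or (b c : Tr Cst.bool) : Tr Cst.bool := boolElim b (fun _ => Cst.bool) c tt

/-- Whether `s` is `tt` before the index `k`. -/
def hit (s : Tr (Cst.nat ⇒ Cst.bool)) (k : Tr Cst.nat) : Tr Cst.bool :=
  natElim k (fun _ => Cst.bool) ff fun k b => or b (s ⬩ k)

end Tr

def Hit : Exp := Pi (Cst.nat ⇒ Cst.bool) fun s => Pi Cst.nat fun k =>
  Eq Cst.bool (Tr.hit ⟨s⟩ ⟨k⟩) Cst.tt ⇒ Ex Cst.nat fun n => Eq Cst.bool (s ⬝ n) Cst.tt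

namespace Tr

def hitFind : Tr Hit :=
  lam fun s => lam fun k =>
    let E : Exp := Ex Cst.nat fun n => Eq Cst.bool (s ⬝ n) Cst.tt
    natElim k (fun k => Eq Cst.bool (hit s k) Cst.tt ⇒ E) (lam fun p => absurd (ffNeTt p.cast))
      -- If nothing was hit before `k`, the disjunction computes to `s k` and `k` is the witness;
      -- otherwise the hypothesis supplies one.
      fun k h => cast (boolElim (hit s k) (fun b => (Eq Cst.bool b Cst.tt ⇒ E) ⇒
          Eq Cst.bool (or b (s ⬩ k)) Cst.tt ⇒ E)
        (lam fun _ => lam fun p => exists' (F := fun n => Eq Cst.bool (s ⬝ n) Cst.tt) k p.cast)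
        (lam fun h => lam fun _ => h ⬩ refl) ⬩ h)

def leAbove (leSucc : Tr LeSucc) (refl : Tr LeRefl) (w : Tr Cst.brw) (k : Tr Cst.nat) :
    Tr (Le w (above w k)) :=
  natElim k (fun k => Le w (above w k)) (refl ⬩ w).cast
    fun k h => cast (leTrans h (leSucc ⬩ above w k))

def numLeAbove (w : Tr Cst.brw) (k : Tr Cst.nat) : Tr (Le (num k) (above w k)) :=
  natElim k (fun k => Le (num k) (above w k)) (leZero (x := w)).cast
    fun _ h => (leSuccMono h).cast

/-- Splitting is applied to `w ≤ v`, for the limit `w` of the numerals and the limit `v` of the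
sequence that jumps from `k` to `w + k` once `tt` has been seen. -/
def lpo : Tr (LeRefl ⇒ LeSucc ⇒ LtIrrefl ⇒ SeqLim ⇒ Hit ⇒ Splitting ⇒ LPO) :=
  lam fun lerefl => lam fun leSucc => lam fun irrefl => lam fun seqLim => lam fun hitFind =>
    lam fun split => lam fun s =>
    let C : Exp := Sum (Pi Cst.nat fun n => Eq Cst.bool (s ⬝ n) Cst.ff)
      (Ex Cst.nat fun n => Eq Cst.bool (s ⬝ n) Cst.tt)
    let nums : Tr (Cst.nat ⇒ Cst.brw) := lam fun k => num k
    sigmaElim (seqLim ⬩ nums ⬩ lam (fun k => cast (lerefl ⬩ bsucc (num k)))) (fun _ => C) fun w hw =>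
    let f : Tr (Cst.nat ⇒ Cst.brw) := lam fun k => jump w (hit s k) k
    let lim : Tr (IsLimit nums w) := hw
    -- The next bit `hit s (k + 1)` computes to `or (hit s k) (s k)`, so strict increase is a
    -- statement about two arbitrary bits.
    let step : Tr (Pi Cst.bool fun b => Pi Cst.bool fun c => Pi Cst.nat fun k =>
        Lt (jump w ⟨b⟩ ⟨k⟩) (jump w (or ⟨b⟩ ⟨c⟩) (suc ⟨k⟩))) :=
      lam fun b => lam fun c => lam fun k =>
        boolElim b (fun b => Lt (jump w b k) (jump w (or b c) (suc k)))
          (cast (boolElim c (fun c => Lt (num k) (jump w c (suc k)))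
            (cast (lerefl ⬩ bsucc (num k))) (cast (leSuccMono (numLeAbove w k)))))
          (cast (lerefl ⬩ bsucc (above w k)))
    have' step fun step =>
    sigmaElim (seqLim ⬩ f ⬩ lam (fun k => cast (step ⬩ hit s k ⬩ (s ⬩ k) ⬩ k))) (fun _ => C) fun v hv =>
    let limv : Tr (IsLimit f v) := hv
    let numLe (k : Tr Cst.nat) : Tr (Le (num k) (f ⬝ k)) := cast <|
      boolElim (hit s k) (fun b => Le (num k) (jump w b k)) (cast (lerefl ⬩ num k))
        (cast (numLeAbove w k))
    let le : Tr (Le w v) := fst (snd lim) ⬩ v ⬩ lam fun k =>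
      cast (leTrans (numLe k) (fst limv ⬩ k))
    let wLe (k : Tr Cst.nat) (p : Tr (Lt w (num k))) : Tr Cst.empty :=
      irrefl ⬩ w ⬩ leTrans p (cast (fst lim ⬩ k))
    cases (split ⬩ w ⬩ v ⬩ le)
      -- From `w < v` some `f k` exceeds `w`; it is not the numeral `k`, since numerals lie below
      -- `w`, so the bit at `k` is `tt`.
      (fun p => inr (exElim exIsProp (snd (snd limv) ⬩ w ⬩ p) fun k q =>
        hitFind ⬩ s ⬩ k ⬩ (boolElim (hit s k) (fun b => Lt w (jump w b k) ⇒ Eq Cst.bool b Cst.tt)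
          (lam fun q => absurd (wLe k q.cast)) (lam fun _ => refl) ⬩ q.cast)))
      (fun p => inl (lam fun n =>
        -- If `s n` were `tt`, the term at `n + 1` would be `w + (n + 1)`, strictly above `w` yet
        -- bounded by `v = w`.
        let lt : Tr (Lt w (jump w (or (hit s n) tt) (suc n))) :=
          boolElim (hit s n) (fun b => Lt w (jump w (or b tt) (suc n)))
            (cast (leSuccMono (leAbove leSucc lerefl w n)))
            (cast (leSuccMono (leAbove leSucc lerefl w n)))
        let no : Tr (Eq Cst.bool (s ⬝ n) Cst.tt ⇒ Cst.empty) := lam fun e =>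
          let lt : Tr (Lt w (f ⬝ (Cst.suc ⬝ n))) :=
            cast (subst (fun c => Lt w (jump w (or (hit s n) c) (suc n))) (symm e) lt)
          irrefl ⬩ w ⬩ leTrans (leTrans lt (fst limv ⬩ suc n))
            (subst (fun x => Le v x) (symm p) (lerefl ⬩ v))
        boolElim (s ⬩ n) (fun b => (Eq Cst.bool b Cst.tt ⇒ Cst.empty) ⇒ Eq Cst.bool b Cst.ff)
          (lam fun _ => refl) (lam fun h => absurd (h ⬩ refl)) ⬩ no))

end Tr

end HoTT

namespace HoTT

/-! ## The equivalences -/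

theorem provable_propIsSet : Provable PropIsSet :=
  Tr.propIsSet.provable.mp Tr.hedberg.provable

theorem provable_propPi : Provable PropPi := Tr.propPi.provable

theorem provable_hPropExt : Provable HPropExt :=
  (Tr.hPropExt.provable.mp (Tr.propIsProp.provable.mp provable_propIsSet)).mp Tr.propExt.provable

theorem provable_brwInd : Provable BrwInd :=
  Tr.brwInd.provable.mp provable_propIsSet

theorem provable_leRefl : Provable LeRefl :=
  Tr.leRefl.provable.mp provable_brwInd

theorem provable_isSet_hProp : Provable (isSet HProp) :=
  (((Tr.hPropIsSet.provable.mp Tr.hedberg.provable).mp provable_propPi).mp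
    Tr.propProd.provable).mp provable_hPropExt

theorem provable_codeElim_ltInv : Provable (CodeElim LtInv) :=
  ((Tr.ltInv.provable.mp provable_propPi).mp provable_brwInd).mp provable_leRefl

theorem provable_ltInv : Provable LtInv :=
  (((Tr.codeElim.provable.mp provable_propPi).mp provable_isSet_hProp).mp
    provable_hPropExt).mp provable_codeElim_ltInv

theorem provable_ltZero : Provable LtZero :=
  Tr.ltZero.provable.mp provable_ltInv

theorem provable_ltSucc : Provable LtSucc :=
  Tr.ltSucc.provable.mp provable_ltInv

theorem provable_ltLimit : Provable LtLimit :=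
  Tr.ltLimit.provable.mp provable_ltInv

theorem provable_leSucc : Provable LeSucc :=
  Tr.leSucc.provable.mp provable_brwInd

theorem provable_ltIrrefl : Provable LtIrrefl :=
  (((((Tr.ltIrrefl.provable.mp provable_propPi).mp provable_brwInd).mp provable_leRefl).mp
    provable_ltZero).mp provable_ltSucc).mp provable_ltLimit

theorem provable_leAntisymm : Provable LeAntisymm :=
  (((((((Tr.leAntisymm.provable.mp provable_propPi).mp provable_brwInd).mp provable_leRefl).mp
    provable_leSucc).mp provable_ltZero).mp provable_ltSucc).mp provable_ltLimit).mp
    provable_ltIrrefl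

theorem provable_dichotomy : Provable (AltLPO ⇒ Dichotomy) :=
  (((((Tr.dichotomy.provable.mp provable_propPi).mp Tr.propSum.provable).mp provable_brwInd).mp
    provable_leRefl).mp provable_ltSucc).mp provable_ltIrrefl

/-- Trichotomy under the limited principle of omniscience, from the properties of the order. -/
def Tr.lpoTrichotomy : Tr ((LPO ⇒ AltLPO) ⇒ (AltLPO ⇒ Dichotomy) ⇒ (Dichotomy ⇒ Trichotomy) ⇒
    LPO ⇒ Trichotomy) :=
  .lam fun f => .lam fun g => .lam fun h => .lam fun l => h ⬩ (g ⬩ (f ⬩ l))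

theorem provable_trichotomy : Provable (LPO ⇒ Trichotomy) :=
  ((Tr.lpoTrichotomy.provable.mp Tr.altLPO.provable).mp provable_dichotomy).mp
    (Tr.trichotomy.provable.mp provable_leAntisymm)

theorem provable_splitting : Provable (Trichotomy ⇒ Splitting) :=
  Tr.splitting.provable.mp provable_ltIrrefl

theorem provable_seqLim : Provable SeqLim :=
  (Tr.seqLim.provable.mp provable_leRefl).mp provable_ltLimit

theorem provable_lpo : Provable (Splitting ⇒ LPO) :=
  ((((Tr.lpo.provable.mp provable_leRefl).mp provable_leSucc).mp provable_ltIrrefl).mp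
    provable_seqLim).mp Tr.hitFind.provable

namespace Tr

/-- Logical equivalence of the first and second of three cyclically implying types. -/
def iffOfCycle (A B C : Exp) : Tr ((A ⇒ B) ⇒ (B ⇒ C) ⇒ (C ⇒ A) ⇒ Iff A B) :=
  lam fun f => lam fun g => lam fun h => prodMk f (lam fun b => h ⬩ (g ⬩ b))

/-- Logical equivalence of the first and third of three cyclically implying types. -/
def iffOfCycle' (A B C : Exp) : Tr ((A ⇒ B) ⇒ (B ⇒ C) ⇒ (C ⇒ A) ⇒ Iff A C) :=
  lam fun f => lam fun g => lam fun h => prodMk (lam fun a => g ⬩ (f ⬩ a)) h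

end Tr

end HoTT

theorem theorem53 :
    HoTT.Provable (HoTT.Iff HoTT.LPO HoTT.Trichotomy) ∧
    HoTT.Provable (HoTT.Iff HoTT.LPO HoTT.Splitting) ∧
    HoTT.Provable (HoTT.Iff HoTT.Trichotomy HoTT.Splitting) := by
  have h := HoTT.provable_trichotomy
  have k := HoTT.provable_splitting
  have l := HoTT.provable_lpo
  exact ⟨(((HoTT.Tr.iffOfCycle _ _ _).provable.mp h).mp k).mp l,
    (((HoTT.Tr.iffOfCycle' _ _ _).provable.mp h).mp k).mp l,
    (((HoTT.Tr.iffOfCycle _ _ _).provable.mp k).mp l).mp h⟩
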